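/- Let $(\mathbf S,\mathbf M)$ be a (connected, oriented) marked surface in the sense of Fomin–Shapiro–Thurston, let $T$ be a triangulation of it whose arcs are all regarded as tagged plain, and let $B(T)=(b_{\beta\gamma})_{\beta,\gamma\in T}$ be its signed adjacency matrix, so that (without self-folded triangles) $b_{\beta\gamma}$ is the number of triangles of $T$ in which $\beta$ follows $\gamma$ counterclockwise minus the number of those in which $\beta$ follows $\gamma$ clockwise. Let $x_\gamma,y_\gamma$ $(\gamma\in T)$ be variables and put $\hat y_\gamma=y_\gamma\prod_{\beta\in T}x_\beta^{b_{\beta\gamma}}$. Let $\alpha$ be a tagged arc. *The monomial $\mathbf g_\alpha$.* Let $\kappa(\alpha)$ be the curve that agrees with $\alpha$ except near its endpoints, where, heading towards the endpoint $p$, it turns left to end on the boundary next to $p$ if $p\in\partial\mathbf S$; it spirals clockwise into $p$ if $p$ is a puncture where $\alpha$ is plain, and counterclockwise if $\alpha$ is notched at $p$. Put $\mathbf g_\alpha=\prod_{\gamma\in T}x_\gamma^{-b_\gamma(T,\kappa(\alpha))}$, where $b_\gamma(T,\cdot)$ are the shear coordinates: each crossing of $\gamma$ by the curve between opposite sides of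 the quadrilateral of $T$ around $\gamma$ contributes $+1$ if the curve turns right in the triangle before $\gamma$ and left in the triangle after it, and $-1$ if it turns left and then right. *Tidy pairs.* The pair $(T,\alpha)$ is tidy if each triangle of $T$ has three distinct vertices and three distinct edges; $\alpha$ has two distinct endpoints; no arc of $T$ intersects the interior of $\alpha$ more than once (in minimal position); no arc of $T$ both intersects the interior of $\alpha$ and shares an endpoint with $\alpha$; and every arc of $T$ with the same two endpoints as $\alpha$ coincides with $\alpha$ except possibly for tagging. *Exchangeable arcs and colors.* An arc $\gamma\in T$ is exchangeable with $\alpha$ if either (a) $\gamma$ and $\alpha$ cross exactly once and have the same tagging at shared endpoints, or (b) they share an endpoint $p$ where $\alpha$ is notched, do not cross, do not coincide up to tagging, and have the same tagging at the other endpoint if they share it too. For $(T,\alpha)$ tidy: (a) The arcs $\alpha$ and $\gamma$ are the diagonals of a quadrilateral, whose sides are tagged as $\alpha$ at the endpoints of $\alpha$ and plain at the endpoints of $\gamma$. Its blue sides are the two that join an endpoint $b$ of $\gamma$ to the endpoint of $\alpha$ that is on the right of someone moving along $\gamma$ from the crossing to $b$; the other two are red. (b) Let $q$ and $r$ be the other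 endpoints of $\gamma$ and $\alpha$. There is one blue arc and one red arc; both join $q$ to $r$, are plain at $q$ and tagged as $\alpha$ at $r$, and together they bound a digon which contains $\alpha\cup\gamma$ and whose only puncture is $p$. Each of them is obtained by following $\gamma$ from $q$ to near $p$, passing by $p$, and following $\alpha$ to $r$; the blue one passes by $p$ on the right-hand side, and the red one on the left-hand side, for someone moving along $\gamma$ from $p$ to $q$. Cutting the digon open along $\alpha$ gives a quadrilateral with diagonal $\gamma$, in which the copy of $\alpha$ opposite to the blue arc is a second (dotted) blue side, and the copy opposite to the red arc is a second (dotted) red side. In both cases, $\mathbf g_{\mathrm{blue}}$ and $\mathbf g_{\mathrm{red}}$ are the products of $\mathbf g_\beta$ over the (non-dotted) blue, respectively red, arcs $\beta$; a side that is a boundary segment contributes $1$. *The monomial $\hat y_{\mathrm{orange}}$.* The elementary lamination $L_\delta$ of $\delta\in T$ agrees with $\delta$ except near its endpoints, where it turns right to end on the boundary, or spirals counterclockwise into a puncture. Reverse its spirals (make them clockwise) at the endpoints of $\alpha$ where $\alpha$ is notched, except, in case (b), at $p$. Call $\delta$ orange if the resulting curve somewhere crosses the quadrilateral from one blue side, across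 $\gamma$, to the other blue side. (In particular $\gamma$ itself is orange.) Let $\hat y_{\mathrm{orange}}$ be the product of $\hat y_\delta$ over all orange $\delta\in T$, and let $|_{y=1}$ denote setting every $y_\gamma$ to $1$. **Proposition.** If $(T,\alpha)$ is tidy and $\gamma\in T$ is exchangeable with $\alpha$, then $$\mathbf g_{\mathrm{blue}}=x_\gamma\cdot\mathbf g_\alpha\qquad\text{and}\qquad \mathbf g_{\mathrm{red}}=x_\gamma\cdot\mathbf g_\alpha\cdot\hat y_{\mathrm{orange}}\big|_{y=1}.$$ -/

import Mathlib

/-!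
# Tagged arcs, shear coordinates and exchanges over a triangulated marked surface

A marked surface with an ideal triangulation `T` is given by its gluing pattern: finitely many
oriented triangles, some of whose sides are glued in pairs (reversing orientation).  The marked
points are the vertices, the glued pairs of sides are the arcs of `T` and the unglued sides are the
boundary segments.  Every marked surface with a triangulation arises in this way, and every isotopy
class of curves between marked points is determined by the sequence of arcs of `T` that it crosses
(or by the arc of `T` with which it coincides).  All arcs of `T` are understood to be tagged plain.
-/

/-- A direction of turning; a curve that enters a triangle through one side leaves it through one
of the two others, so it turns left or right. -/
inductive Turn : Type
  | left : Turn
  | right : Turn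

def Turn.flip : Turn → Turn
  | .left => .right
  | .right => .left

inductive Tag : Type
  | plain : Tag
  | notched : Tag

/-- A triangulated oriented surface, as a gluing of triangles.  The elements of `D` are the sides of
the triangles, each directed so that its triangle lies on its left.  `next` goes counterclockwise
around a triangle, and `opp` sends a side to the side that it is glued to (with the opposite
direction), or to itself if it is a boundary segment. -/
structure Triangulation (D : Type*) where
  next : D → D
  opp : D → D
  next_next_next : ∀ d, next (next (next d)) = d
  next_ne : ∀ d, next d ≠ d
  opp_opp : ∀ d, opp (opp d) = d

/-- The combinatorial description of a curve between two marked points, with a chosen direction: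
* `along a`: the curve runs along the side `a`, in the direction of `a`;
* `across d ts`: the curve starts at the vertex opposite to `d` in the triangle of `d`, leaves this
  triangle across `d`, makes the turns `ts` in the triangles that it then goes through, and ends
  in the triangle that it then enters, at the vertex opposite to the side that it entered by. -/
inductive ArcPath (D : Type*) : Type _
  | along (a : D) : ArcPath D
  | across (d : D) (ts : List Turn) : ArcPath D

structure TaggedArc (D : Type*) where
  path : ArcPath D
  startTag : Tag
  endTag : Tag

namespace Triangulation

variable {D : Type*} (T : Triangulation D)

/-! ### Marked points and arcs of the triangulation -/

/-- The marked points: two sides start at the same point iff they are related by rotating about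
that point through triangles (`T.next (T.opp d)` is the next side after `d` clockwise around the
starting point of `d`). -/
def Vertex : Type _ := Quot fun d d' : D => T.opp d ≠ d ∧ d' = T.next (T.opp d)

/-- The starting point of a side. -/
def src (d : D) : T.Vertex := Quot.mk _ d

/-- The final point of a side. -/
def tgt (d : D) : T.Vertex := T.src (T.next d)

/-- A puncture is a marked point in the interior, i.e. one where no boundary segment starts (or
equivalently ends). -/
def IsPuncture (v : T.Vertex) : Prop := ∀ d, T.src d = v → T.opp d ≠ d

/-- The arcs of `T`: glued pairs of sides. -/
def Arc : Type _ := {s : Set D // ∃ d, T.opp d ≠ d ∧ s = {d, T.opp d}}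

noncomputable instance [Finite D] : Fintype T.Arc :=
  @Fintype.ofFinite _ (inferInstanceAs (Finite {s : Set D // ∃ d, T.opp d ≠ d ∧ s = {d, T.opp d}}))

/-- `v` is an endpoint of the arc `γ`. -/
def IsEnd (γ : T.Arc) (v : T.Vertex) : Prop := ∃ d ∈ γ.1, T.src d = v

/-- The surface is connected, and it is not one of the excluded ones.  The excluded surfaces that
have a triangulation by at least one triangle are the unpunctured triangle and the once-punctured
monogon (each consisting of a single triangle) and the sphere with three punctures (two triangles,
three vertices, no boundary). -/
def IsMarkedSurface : Prop :=
  Nonempty D ∧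
  (∀ d d', Relation.ReflTransGen (fun a b => b = T.next a ∨ b = T.opp a) d d') ∧
  Nat.card D ≠ 3 ∧
  ¬ ((∀ d, T.opp d ≠ d) ∧ Nat.card D = 6 ∧ Nat.card T.Vertex = 3)

/-! ### Tagged arcs -/

/-- The side by which a curve leaves a triangle that it has entered through the side `e`. -/
def exit : Turn → D → D
  | .right, e => T.next e
  | .left, e => T.next (T.next e)

/-- The sides crossed by a curve that crosses `d` and then makes the turns `ts`. -/
def crossFrom : D → List Turn → List D
  | d, [] => [d]
  | d, t :: ts => d :: crossFrom (T.exit t (T.opp d)) ts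

/-- The last one of these sides. -/
def lastCross : D → List Turn → D
  | d, [] => d
  | d, t :: ts => lastCross (T.exit t (T.opp d)) ts

def crossings : ArcPath D → List D
  | .along _ => []
  | .across d ts => T.crossFrom d ts

def startPt : ArcPath D → T.Vertex
  | .along a => T.src a
  | .across d _ => T.src (T.next (T.next d))

def endPt : ArcPath D → T.Vertex
  | .along a => T.tgt a
  | .across d ts => T.src (T.next (T.next (T.opp (T.lastCross d ts))))

def revPath : ArcPath D → ArcPath D
  | .along a => .along (T.opp a)
  | .across d ts => .across (T.opp (T.lastCross d ts)) (ts.reverse.map Turn.flip)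

/-- `α` describes a tagged curve of the surface: it crosses, or runs along, arcs and not boundary
segments, and it is notched at punctures only.  (An arc must moreover not cross itself.  This is
automatic for the tidy pairs below: there, `α` goes through pairwise different triangles.) -/
structure IsTaggedArc (α : TaggedArc D) : Prop where
  interior_cross : ∀ d ∈ T.crossings α.path, T.opp d ≠ d
  interior_along : ∀ a, α.path = .along a → T.opp a ≠ a
  start_tag : α.startTag = .notched → T.IsPuncture (T.startPt α.path)
  end_tag : α.endTag = .notched → T.IsPuncture (T.endPt α.path)

/-- `α` coincides with the arc `γ` of `T`, except possibly for tagging. -/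
def Coincides (α : TaggedArc D) (γ : T.Arc) : Prop := ∃ a ∈ γ.1, α.path = .along a

open Classical in
/-- The number of times that `γ` intersects the interior of `α`. -/
noncomputable def crossNumber (α : TaggedArc D) (γ : T.Arc) : ℕ :=
  (T.crossings α.path).countP (fun d => d ∈ γ.1)

/-- Tidyness of the pair `(T, α)`. -/
structure Tidy (α : TaggedArc D) : Prop where
  distinct_vertices : ∀ d, T.src d ≠ T.src (T.next d)
  distinct_edges : ∀ d, T.opp d ≠ T.next d ∧ T.opp d ≠ T.next (T.next d)
  distinct_ends : T.startPt α.path ≠ T.endPt α.path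
  cross_once : ∀ γ : T.Arc, T.crossNumber α γ ≤ 1
  cross_or_share : ∀ γ : T.Arc, T.crossNumber α γ ≠ 0 →
    ¬ T.IsEnd γ (T.startPt α.path) ∧ ¬ T.IsEnd γ (T.endPt α.path)
  same_ends : ∀ γ : T.Arc, T.IsEnd γ (T.startPt α.path) → T.IsEnd γ (T.endPt α.path) →
    T.Coincides α γ

/-! ### Curves of laminations, and shear coordinates

A curve that ends on boundary segments or spirals into punctures is described by the two-sided
sequence of the sides that it crosses, each side directed as a side of the triangle that the curve
leaves there.  A `none` means that the curve has ended.  A spiral into a puncture is an infinite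
sequence of equal turns; if these turns are made around a marked point on the boundary, the
sequence reaches a boundary segment, and the curve ends there. -/

section

variable [DecidableEq D]

/-- The sides crossed by a curve that crosses `d` and then makes the turns `t 0, t 1, …` until it
reaches a boundary segment. -/
def ray (d : D) (t : ℕ → Turn) : ℕ → Option D
  | 0 => some d
  | n + 1 => (ray d t n).bind fun x =>
      if T.opp x = x then none else some (T.exit (t n) (T.opp x))

/-- The curve formed by two rays that leave the same triangle: it comes in along the
second ray, traversed backwards, and goes out along the first one. -/
def joinRays (r₁ r₂ : ℕ → Option D) : ℤ → Option D
  | .ofNat n => r₁ n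
  | .negSucc n => (r₂ n).map T.opp

/-- The curve that agrees with the path `p` except near the two endpoints, where, heading towards
the endpoint, it passes by the endpoint with a turn `s` (at the start of `p`) or `e` (at the end of
`p`), and then ends on the first boundary segment it reaches, or spirals into the puncture, with the
endpoint always on the other side.  So a turn to the left gives a clockwise spiral, and a turn to
the right gives a counterclockwise spiral.  (In the last case, the direction is reversed.) -/
def curve (p : ArcPath D) (s e : Turn) : ℤ → Option D :=
  match p, s, e with
  | .across d ts, s, e =>
      T.joinRays (T.ray d fun n => (ts ++ [e]).getD n e.flip) (T.ray (T.exit s d) fun _ => s.flip)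
  | .along a, .left, .left =>
      T.joinRays (T.ray (T.next a) fun _ => .right) (T.ray a fun _ => .right)
  | .along a, .right, .right =>
      T.joinRays (T.ray a fun _ => .left) (T.ray (T.next (T.next a)) fun _ => .left)
  | .along a, .right, .left =>
      T.joinRays (T.ray (T.next a) fun _ => .right) (T.ray (T.next (T.next a)) fun _ => .left)
  | .along a, .left, .right =>
      T.joinRays (T.ray (T.next (T.opp a)) fun _ => .right)
        (T.ray (T.next (T.next (T.opp a))) fun _ => .left)

/-- The curve `κ(α)`: a turn to the left (clockwise spiral) at the endpoints where `α` is plain, to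
the right (counterclockwise spiral) where it is notched. -/
def kappa (α : TaggedArc D) : ℤ → Option D :=
  let turn : Tag → Turn := fun
    | .plain => .left
    | .notched => .right
  T.curve α.path (turn α.startTag) (turn α.endTag)

end

/-- The sequence of sides crossed by `c` has `w, x, y` at the places `i - 1, i, i + 1`, where
`c` turns by `t` between `w` and `x`, and by `t'` between `x` and `y`. -/
def HasTurns (c : ℤ → Option D) (i : ℤ) (t t' : Turn) : Prop :=
  ∃ w x y, c (i - 1) = some w ∧ c i = some x ∧ c (i + 1) = some y ∧
    x = T.exit t (T.opp w) ∧ y = T.exit t' (T.opp x)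

open Classical in
/-- The contribution of the `i`-th crossing to the shear coordinates: in the quadrilateral formed
by the two triangles at the side that is crossed, the curve joins two opposite sides if it turns
right and then left (contribution `1`) or left and then right (contribution `-1`). -/
noncomputable def crossSign (c : ℤ → Option D) (i : ℤ) : ℤ :=
  if T.HasTurns c i .right .left then 1
  else if T.HasTurns c i .left .right then -1
  else 0

open Classical in
/-- The shear coordinate `b_γ(T, c)` (in the absence of self-folded triangles).  Only finitely many
terms are nonzero, if the curve finally spirals at both of its ends. -/
noncomputable def shear (γ : T.Arc) (c : ℤ → Option D) : ℤ :=
  ∑ᶠ i : ℤ, if ∃ x ∈ γ.1, c i = some x then T.crossSign c i else 0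

open Classical in
/-- The signed adjacency matrix (in the absence of self-folded triangles): `b β γ` is the number of
triangles in which `β` follows `γ` counterclockwise, minus the number of triangles in which `β`
follows `γ` clockwise. -/
noncomputable def adj [Fintype D] (β γ : T.Arc) : ℤ :=
  ∑ d : D, if d ∈ γ.1 then
    (if T.next d ∈ β.1 then 1 else 0) - (if T.next (T.next d) ∈ β.1 then 1 else 0) else 0

/-! ### Laurent monomials -/

/-- The group of Laurent monomials in the variables `x_γ` and `y_γ`, for the arcs `γ` of `T`, given
by their exponent vectors. -/
abbrev Monomial : Type _ := Multiplicative (T.Arc ⊕ T.Arc → ℤ)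

open Classical in
/-- The initial cluster variable `x_γ`. -/
noncomputable def x (γ : T.Arc) : T.Monomial := Multiplicative.ofAdd (Pi.single (Sum.inl γ) 1)

open Classical in
/-- The tropical variable `y_γ`. -/
noncomputable def y (γ : T.Arc) : T.Monomial := Multiplicative.ofAdd (Pi.single (Sum.inr γ) 1)

/-- Setting every tropical variable to `1`. -/
def setYOne : T.Monomial →* T.Monomial where
  toFun m := Multiplicative.ofAdd (Sum.elim (fun γ => m.toAdd (Sum.inl γ)) 0)
  map_one' := by
    apply Multiplicative.toAdd.injective
    funext γ
    cases γ <;> rfl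
  map_mul' m n := by
    apply Multiplicative.toAdd.injective
    funext γ
    cases γ <;> rfl

/-- `ŷ_γ = y_γ ∏_β x_β ^ b_{βγ}`. -/
noncomputable def yhat [Fintype D] (γ : T.Arc) : T.Monomial :=
  T.y γ * ∏ β : T.Arc, T.x β ^ T.adj β γ

/-- `g_α = ∏_γ x_γ ^ (-b_γ(T, κ(α)))`. -/
noncomputable def g [Fintype D] [DecidableEq D] (α : TaggedArc D) : T.Monomial :=
  ∏ γ : T.Arc, T.x γ ^ (-T.shear γ (T.kappa α))

/-! ### Exchanges

We describe a curve crossing an arc of `T` from the point of view of the crossing. -/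

/-- A curve between marked points that crosses a side `cross`.  On the far side of `cross`
it makes the turns `fwd` and then ends at the vertex opposite to the side it entered by; followed
backwards from the crossing, it makes the turns `bwd` and then ends in the same way. -/
structure Transversal (D : Type*) where
  cross : D
  fwd : List Turn
  bwd : List Turn

/-- One step clockwise around the starting point of a side. -/
def cw (d : D) : D := T.next (T.opp d)

/-- One step counterclockwise around the starting point of a side. -/
def ccw (d : D) : D := T.opp (T.next (T.next d))

/-- Let the path `p` and the side `g` start at the same puncture.  This is the curve that crosses
`g` near this puncture, then goes around the puncture, clockwise as well as counterclockwise, until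
it reaches `p`, and then runs alongside `p` up to the final point of `p`, in both directions.  Its
two ends, and the one of `g`, are corners of the digon around the puncture (cut open along `p`). -/
noncomputable def around (p : ArcPath D) (g : D) : Transversal D :=
  match p with
  | .across d ts =>
    { cross := g
      fwd := List.replicate (sInf {k | T.cw^[k + 1] g = T.next (T.next d)}) .right ++ .left :: ts
      bwd := List.replicate (sInf {k | T.ccw^[k] g = T.next (T.next d)}) .left ++ .right :: ts }
  | .along a =>
    { cross := g
      fwd := List.replicate (sInf {k | T.cw^[k + 1] g = a}) .right
      bwd := List.replicate (sInf {k | T.ccw^[k + 1] g = a}) .left }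

/-- A curve enters a triangle through `e` (seen from inside this triangle), makes the turns `ts` and
ends at the opposite vertex, where it is tagged `tag`.  This is the arc, tagged plain at its other
endpoint, that connects the left endpoint of `e` with that vertex by following the curve.  (As long
as the curve turns left, it goes around that endpoint.) -/
def leftSide : D → List Turn → Tag → TaggedArc D
  | e, [], tag => ⟨.along (T.next (T.next e)), tag, .plain⟩
  | e, .left :: ts, tag => leftSide (T.opp (T.exit .left e)) ts tag
  | e, .right :: ts, tag => ⟨.across (T.exit .right e) ts, .plain, tag⟩

/-- The same with the right endpoint of `e`. -/
def rightSide : D → List Turn → Tag → TaggedArc D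
  | e, [], tag => ⟨.along (T.next e), .plain, tag⟩
  | e, .right :: ts, tag => rightSide (T.opp (T.exit .right e)) ts tag
  | e, .left :: ts, tag => ⟨.across (T.exit .left e) ts, .plain, tag⟩

/-- The ways in which the tagged arc `α` and the (plain) arc `γ` of `T` admit an exchange relation:
* they cross exactly once, and have the same tagging at shared endpoints;
* they share an endpoint where their taggings disagree, they do not cross and do not coincide up to
  tagging, and if they also share the other endpoint, they have the same tagging there. -/
inductive Exchange (α : TaggedArc D) (γ : T.Arc) : Type _
  | crossing (d : D) (ts₁ ts₂ : List Turn) (path_eq : α.path = .across d (ts₁ ++ ts₂))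
      (mem : T.lastCross d ts₁ ∈ γ.1) (once : T.crossNumber α γ = 1)
      (start_plain : T.IsEnd γ (T.startPt α.path) → α.startTag = .plain)
      (end_plain : T.IsEnd γ (T.endPt α.path) → α.endTag = .plain) : Exchange α γ
  | sharedStart (a : D) (mem : a ∈ γ.1) (src_eq : T.src a = T.startPt α.path)
      (start_notched : α.startTag = .notched) (no_cross : T.crossNumber α γ = 0)
      (not_coincide : ¬ T.Coincides α γ)
      (end_plain : T.tgt a = T.endPt α.path → α.endTag = .plain) : Exchange α γ
  | sharedEnd (a : D) (mem : a ∈ γ.1) (src_eq : T.src a = T.endPt α.path)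
      (end_notched : α.endTag = .notched) (no_cross : T.crossNumber α γ = 0)
      (not_coincide : ¬ T.Coincides α γ)
      (start_plain : T.tgt a = T.startPt α.path → α.startTag = .plain) : Exchange α γ

variable {T}

namespace Exchange

variable {α : TaggedArc D} {γ : T.Arc}

/-- The curve that crosses the arc `γ` between the two sides of the quadrilateral at one end of `γ`
and the two sides at the other end: the diagonal `α`, if `α` and `γ` cross, and otherwise the
curve that follows `α` to the shared puncture, goes around it, and comes back. -/
noncomputable def transversal : T.Exchange α γ → Transversal D
  | .crossing d ts₁ ts₂ _ _ _ _ _ => ⟨T.lastCross d ts₁, ts₂, ts₁.reverse.map Turn.flip⟩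
  | .sharedStart a _ _ _ _ _ _ => T.around α.path a
  | .sharedEnd a _ _ _ _ _ _ => T.around (T.revPath α.path) a

/-- The (non-dotted) blue arcs.  If `α` and `γ` cross, they form a quadrilateral with diagonals `α`
and `γ`, together with the red arcs; the blue ones are those that join an endpoint of `γ` with the
endpoint of `α` on the right, for someone moving along `γ` towards the former endpoint from
the crossing.  If `α` and `γ` share a puncture, then there is one blue and one red arc, forming a
digon around the puncture and joining the two other endpoints; the blue one passes by the puncture
on the right of someone moving along `γ` from the puncture to its other endpoint.  In both cases
these are the sides that lie on the left of the transversal curve, followed away from `γ`, and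
the choice of the colors is the one for which the elementary lamination of `γ` crosses
blue-purple-blue. -/
noncomputable def blue (E : T.Exchange α γ) : List (TaggedArc D) :=
  let η := E.transversal
  match E with
  | .crossing .. =>
      [T.leftSide (T.opp η.cross) η.fwd α.endTag, T.leftSide η.cross η.bwd α.startTag]
  | .sharedStart .. => [T.leftSide (T.opp η.cross) η.fwd α.endTag]
  | .sharedEnd .. => [T.leftSide (T.opp η.cross) η.fwd α.startTag]

/-- The (non-dotted) red arcs. -/
noncomputable def red (E : T.Exchange α γ) : List (TaggedArc D) :=
  let η := E.transversal
  match E with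
  | .crossing .. =>
      [T.rightSide (T.opp η.cross) η.fwd α.endTag, T.rightSide η.cross η.bwd α.startTag]
  | .sharedStart .. => [T.rightSide η.cross η.bwd α.endTag]
  | .sharedEnd .. => [T.rightSide η.cross η.bwd α.startTag]

/-- The marked points where the spirals of the elementary laminations are reversed: the endpoints
of `α` where `α` is notched, but not the endpoint shared with `γ` if the taggings disagree there. -/
def SpiralReversed (E : T.Exchange α γ) (v : T.Vertex) : Prop :=
  match E with
  | .crossing .. => (v = T.startPt α.path ∧ α.startTag = .notched) ∨
      (v = T.endPt α.path ∧ α.endTag = .notched)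
  | .sharedStart .. => v = T.endPt α.path ∧ α.endTag = .notched
  | .sharedEnd .. => v = T.startPt α.path ∧ α.startTag = .notched

end Exchange

variable (T)

/-- A curve, given by the sides `q 0, q 1, …` that it crosses, enters a triangle through `e`
together with another curve, which makes the turns `ts` and then ends at a vertex.  The two
curves run through the same triangles until the first one departs to the left, at the latest in the
triangle in which the second one ends.  So the first curve then crosses the arc `leftSide`. -/
def DepartsLeft : D → List Turn → (ℕ → Option D) → Prop
  | e, [], q => q 0 = some (T.exit .left e)
  | e, t :: ts, q => (t = .right ∧ q 0 = some (T.exit .left e)) ∨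
      (q 0 = some (T.exit t e) ∧
        DepartsLeft (T.opp (T.exit t e)) ts fun n => q (n + 1))

/-- The curve `c` crosses the side `η.cross`, and on both sides of this crossing it departs
from `η` to the left.  So it crosses a side on the left of `η`, then `η.cross`, then the other
side on the left of `η`. -/
def CrossesLeftLeft (η : Transversal D) (c : ℤ → Option D) : Prop :=
  ∃ i : ℤ,
    (c i = some η.cross ∧
      T.DepartsLeft (T.opp η.cross) η.fwd (fun n => c (i + 1 + n)) ∧
      T.DepartsLeft η.cross η.bwd (fun n => (c (i - 1 - n)).map T.opp)) ∨
    (c i = some (T.opp η.cross) ∧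
      T.DepartsLeft η.cross η.bwd (fun n => c (i + 1 + n)) ∧
      T.DepartsLeft (T.opp η.cross) η.fwd (fun n => (c (i - 1 - n)).map T.opp))

variable {T}

namespace Exchange

variable {α : TaggedArc D} {γ : T.Arc} [DecidableEq D]

open Classical in
/-- The elementary lamination of the arc of `T` with side `a`, with the spirals reversed where this
is prescribed: a turn to the right (counterclockwise spiral) at both endpoints, except where the
spiral is reversed. -/
noncomputable def lamination (E : T.Exchange α γ) (a : D) : ℤ → Option D :=
  let turn : T.Vertex → Turn := fun v => if E.SpiralReversed v then .left else .right
  T.curve (.along a) (turn (T.src a)) (turn (T.tgt a))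

/-- The lamination of `δ` has a blue-purple-blue intersection.  (If `α` and `γ` share a puncture, the
second blue side, on the left of the transversal curve, is the dotted one that coincides with `α`.) -/
def Orange (E : T.Exchange α γ) (δ : T.Arc) : Prop :=
  ∃ a ∈ δ.1, T.CrossesLeftLeft E.transversal (E.lamination a)

variable [Fintype D]

open Classical in
/-- `ŷ_orange`, the product of the `ŷ_δ` for all orange `δ`. -/
noncomputable def yhatOrange (E : T.Exchange α γ) : T.Monomial :=
  ∏ δ : T.Arc, if E.Orange δ then T.yhat δ else 1

variable (T) in
open Classical in
/-- The product of the monomials `g_β` of a list of arcs, boundary segments being left out. -/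
noncomputable def gProd (l : List (TaggedArc D)) : T.Monomial :=
  (l.map fun β => if ∃ a, β.path = .along a ∧ T.opp a = a then 1 else T.g β).prod

noncomputable def gBlue (E : T.Exchange α γ) : T.Monomial := gProd T E.blue

noncomputable def gRed (E : T.Exchange α γ) : T.Monomial := gProd T E.red

end Exchange

end Triangulation

/-! Give a right turn weight 1 and a left turn weight 0. A crossing between turns `t` and `t'` then
contributes the weight of `t` minus that of `t'` to the shear coordinates (`crossSign_eq`), so
spirals contribute only where they begin and everything becomes a finite sum over turns,
`halfShear`. The turn made before entering a half curve affects only its first term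
(`halfShear_sub`), so a curve can be cut at any crossing.

Suppose that `α` crosses `γ` at `g`. Cut `α` there into two halves, and let `F` and `B` be their
shear coordinates when each half is entered after a left turn. The shear vector of `α` is `F + B +
ind g`, because the two halves see opposite turns at `g`. The blue sides have shear vectors `F` and
`B` (`sideShear_leftSide`), which is the blue identity. A red side is entered as after a right turn,
up to a correction, since its clockwise spiral lies on the wrong side of the common endpoint. By
`sideShear_rightSide` the correction consists of corner terms at the arcs of a `fan`, and these pair
up to columns of the signed adjacency matrix (`adj_eq`).

It remains to see that `g` and the two fans are exactly the orange arcs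
(`exists_crossesLeftLeft_iff`), each occurring once (`orangeSides_nodup`). An elementary lamination
is a pair of spirals, so it departs from the transversal to the left on both sides only if it runs
along the transversal around an endpoint of `g`, which is what membership in a fan says.

If `α` and `γ` share a puncture `p`, the same computation is applied to the curve around `p`. Its
turns around `p` are all equal on each side and cost nothing, so its forward half, entered after a
right turn, has the shear coordinates of `α`. Its backward half, entered after a left turn, has
those of `α` retagged plain at `p`. The latter arc is also the `rightSide` of the forward half, so
`sideShear_rightSide` compares the two (`exchange_relation`). -/

/-- The weight of a turn: `1` to the right and `0` to the left. -/
def Turn.weight : Turn → ℤ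
  | .left => 0
  | .right => 1

@[simp] theorem Turn.flip_flip (t : Turn) : t.flip.flip = t := by cases t <;> rfl

theorem Turn.weight_flip (t : Turn) : t.flip.weight = 1 - t.weight := by cases t <;> rfl

/-- The turn by which a curve with the spirals of `kappa` arrives at an endpoint. -/
def Tag.turn : Tag → Turn
  | .plain => .left
  | .notched => .right

namespace Triangulation

variable {D : Type*} (T : Triangulation D)

@[simp] theorem exit_flip_exit (t : Turn) (e : D) : T.exit t.flip (T.exit t e) = e := by
  cases t <;> exact T.next_next_next e

@[simp] theorem exit_exit_flip (t : Turn) (e : D) : T.exit t (T.exit t.flip e) = e := by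
  cases t <;> exact T.next_next_next e

theorem exit_inj {t t' : Turn} {e : D} (h : T.exit t e = T.exit t' e) : t = t' := by
  cases t <;> cases t' <;>
    first | rfl | exact absurd h (T.next_ne _) | exact absurd h.symm (T.next_ne _)

theorem next_injective : Function.Injective T.next := fun a b h => by
  rw [← T.next_next_next a, h, T.next_next_next]

theorem opp_injective : Function.Injective T.opp := fun a b h => by
  rw [← T.opp_opp a, h, T.opp_opp]

theorem opp_opp_ne {d : D} (h : T.opp d ≠ d) : T.opp (T.opp d) ≠ T.opp d := fun h' =>
  h (T.opp_injective h')

theorem mem_arc_opp {γ : T.Arc} {d : D} : T.opp d ∈ γ.1 ↔ d ∈ γ.1 := by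
  obtain ⟨s, a, ha, rfl⟩ := γ
  simp only [Set.mem_insert_iff, Set.mem_singleton_iff]
  constructor
  · rintro (h | h)
    · right; rw [← h, T.opp_opp]
    · left; exact T.opp_injective h
  · rintro (h | h)
    · right; rw [h]
    · left; rw [h, T.opp_opp]

theorem opp_ne_of_mem {γ : T.Arc} {d : D} (h : d ∈ γ.1) : T.opp d ≠ d := by
  obtain ⟨s, a, ha, rfl⟩ := γ
  rcases h with rfl | h
  · exact ha
  · rw [Set.mem_singleton_iff] at h
    subst h
    exact T.opp_opp_ne ha

theorem arc_eq_pair {γ : T.Arc} {d : D} (h : d ∈ γ.1) : γ.1 = {d, T.opp d} := by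
  obtain ⟨s, a, ha, rfl⟩ := γ
  rcases h with rfl | h
  · rfl
  · rw [Set.mem_singleton_iff] at h
    subst h
    exact (Set.pair_comm _ _).trans (by rw [T.opp_opp])

/-- The arc with a given glued side. -/
def arcOf (d : D) (h : T.opp d ≠ d) : T.Arc := ⟨{d, T.opp d}, d, h, rfl⟩

theorem mem_arcOf (d : D) (h : T.opp d ≠ d) : d ∈ (T.arcOf d h).1 := Or.inl rfl

theorem arc_eq_of_mem {γ δ : T.Arc} {d : D} (h : d ∈ γ.1) (h' : d ∈ δ.1) : γ = δ :=
  Subtype.ext ((T.arc_eq_pair h).trans (T.arc_eq_pair h').symm)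

open Classical in
/-- The indicator of the arc to which a side belongs (zero for boundary segments). -/
noncomputable def ind (d : D) (γ : T.Arc) : ℤ := if d ∈ γ.1 then 1 else 0

open Classical in
theorem ind_opp (d : D) : T.ind (T.opp d) = T.ind d := by
  funext γ
  exact if_congr T.mem_arc_opp rfl rfl

theorem ind_boundary {d : D} (h : T.opp d = d) : T.ind d = 0 := by
  funext γ
  simp only [ind, Pi.zero_apply]
  exact if_neg fun h' => T.opp_ne_of_mem h' h

/-! ### Shear coordinates as finite sums -/

/-- The shear coordinates of the part of a curve that enters a triangle through `e`, after
a turn `σ`, makes the turns `ts`, and then passes by its final point with a turn `τ`. -/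
noncomputable def halfShear : Turn → D → List Turn → Turn → T.Arc → ℤ
  | σ, e, [], τ => (σ.weight - τ.weight) • T.ind e + (τ.weight - τ.flip.weight) • T.ind (T.exit τ e)
  | σ, e, t :: ts, τ =>
      (σ.weight - t.weight) • T.ind e + halfShear t (T.opp (T.exit t e)) ts τ

theorem halfShear_nil (σ : Turn) (e : D) (τ : Turn) (γ : T.Arc) :
    T.halfShear σ e [] τ γ = (σ.weight - τ.weight) * T.ind e γ +
      (τ.weight - τ.flip.weight) * T.ind (T.exit τ e) γ := rfl

theorem halfShear_cons (σ : Turn) (e : D) (t : Turn) (ts : List Turn) (τ : Turn) (γ : T.Arc) :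
    T.halfShear σ e (t :: ts) τ γ = (σ.weight - t.weight) * T.ind e γ +
      T.halfShear t (T.opp (T.exit t e)) ts τ γ := rfl

/-- Only the first crossing sees the incoming turn. This is the source of every factor `x γ` in the
exchange relations. -/
theorem halfShear_sub (σ σ' : Turn) (e : D) (ts : List Turn) (τ : Turn) :
    T.halfShear σ e ts τ - T.halfShear σ' e ts τ = (σ.weight - σ'.weight) • T.ind e := by
  cases ts <;> simp only [halfShear] <;> module

open Classical in
theorem crossSign_eq {c : ℤ → Option D} {i : ℤ} {w x y : D} {t t' : Turn} (hw : c (i - 1) = some w)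
    (hx : c i = some x) (hy : c (i + 1) = some y) (h : x = T.exit t (T.opp w))
    (h' : y = T.exit t' (T.opp x)) : T.crossSign c i = t.weight - t'.weight := by
  have key : ∀ s s', T.HasTurns c i s s' ↔ s = t ∧ s' = t' := by
    intro s s'
    constructor
    · rintro ⟨w', x', y', hw', hx', hy', h1, h2⟩
      rw [hw, Option.some_inj] at hw'
      rw [hx, Option.some_inj] at hx'
      rw [hy, Option.some_inj] at hy'
      subst hw' hx' hy'
      exact ⟨T.exit_inj (h1.symm.trans h), T.exit_inj (h2.symm.trans h')⟩
    · rintro ⟨rfl, rfl⟩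
      exact ⟨w, x, y, hw, hx, hy, h, h'⟩
  simp only [crossSign, key]
  cases t <;> cases t' <;> simp [Turn.weight]

section

variable [DecidableEq D]

/-- The turn before the `n`-th crossing of a ray. -/
def prevTurn (σ : Turn) (t : ℕ → Turn) : ℕ → Turn
  | 0 => σ
  | n + 1 => t n

/-- The contribution of the `n`-th crossing of a ray, made after a turn `σ`. -/
noncomputable def rayTerm (σ : Turn) (d : D) (t : ℕ → Turn) (γ : T.Arc) (n : ℕ) : ℤ :=
  ((T.ray d t n).elim 0 fun x => T.ind x γ) * ((prevTurn σ t n).weight - (t n).weight)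

theorem ray_succ_of_interior {d : D} (h : T.opp d ≠ d) (t : ℕ → Turn) (n : ℕ) :
    T.ray d t (n + 1) = T.ray (T.exit (t 0) (T.opp d)) (fun k => t (k + 1)) n := by
  induction n with
  | zero => simp [ray, h]
  | succ n ih => rw [ray, ih, ray]

/-- After the first crossing, all crossings of a spiral lie between equal turns and contribute zero.
-/
theorem hasSum_rayTerm_const (σ τ : Turn) (d : D) (γ : T.Arc) :
    HasSum (T.rayTerm σ d (fun _ => τ) γ) ((σ.weight - τ.weight) * T.ind d γ) := by
  have h0 : HasSum (fun n => T.rayTerm σ d (fun _ => τ) γ (n + 1)) 0 := by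
    have : (fun n => T.rayTerm σ d (fun _ => τ) γ (n + 1)) = fun _ => 0 := by
      funext n; simp [rayTerm, prevTurn]
    rw [this]; exact hasSum_zero
  have := h0.zero_add
  rwa [add_zero, rayTerm, mul_comm] at this

theorem hasSum_rayTerm_step {σ τ : Turn} {d : D} {t t' : ℕ → Turn} {γ : T.Arc} {v : ℤ}
    (hd : T.opp d ≠ d) (h0 : t 0 = τ) (ht : ∀ k, t (k + 1) = t' k)
    (h : HasSum (T.rayTerm τ (T.exit τ (T.opp d)) t' γ) v) :
    HasSum (T.rayTerm σ d t γ) ((σ.weight - τ.weight) * T.ind d γ + v) := by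
  obtain rfl : (fun k => t (k + 1)) = t' := funext ht
  subst h0
  have h0 : HasSum (fun n => T.rayTerm σ d t γ (n + 1)) v := by
    refine h.congr_fun fun n => ?_
    simp only [rayTerm, T.ray_succ_of_interior hd]
    cases n <;> rfl
  have := h0.zero_add
  rwa [rayTerm, mul_comm] at this

/-- The turns made at the end of a path: the last turn `τ`, followed by a spiral. -/
theorem hasSum_rayTerm_path (σ : Turn) (d : D) (ts : List Turn) (τ : Turn) (γ : T.Arc)
    (h : ∀ x ∈ T.crossFrom d ts, T.opp x ≠ x) :
    HasSum (T.rayTerm σ d (fun n => (ts ++ [τ]).getD n τ.flip) γ)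
      (T.halfShear σ (T.opp d) ts τ γ) := by
  induction ts generalizing σ d with
  | nil =>
    have hd : T.opp d ≠ d := h d (List.mem_singleton_self d)
    have := T.hasSum_rayTerm_step (σ := σ) (τ := τ) (t := fun n => ([] ++ [τ]).getD n τ.flip) hd rfl
      (fun k => by simp) (T.hasSum_rayTerm_const τ τ.flip (T.exit τ (T.opp d)) γ)
    rw [T.halfShear_nil]
    rw [T.ind_opp d]
    exact this
  | cons t ts ih =>
    have hd : T.opp d ≠ d := h d List.mem_cons_self
    have := T.hasSum_rayTerm_step (σ := σ) (t := fun n => (t :: ts ++ [τ]).getD n τ.flip) hd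
      (by simp) (fun k => by simp)
      (ih t (T.exit t (T.opp d)) fun x hx => h x (List.mem_cons_of_mem d hx))
    rwa [T.halfShear_cons, T.ind_opp d]

-- The hypothesis `hy` is restricted to interior sides because the curve stops at a boundary
-- segment; such a segment lies in no arc, and both sides of the equation vanish there.
omit [DecidableEq D] in
open Classical in
theorem shearTerm_eq {c : ℤ → Option D} {i : ℤ} {w x : D} {t t' : Turn} {γ : T.Arc}
    (hw : c (i - 1) = some w) (hx : c i = some x) (h : x = T.exit t (T.opp w))
    (hy : T.opp x ≠ x → c (i + 1) = some (T.exit t' (T.opp x))) :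
    (if ∃ x ∈ γ.1, c i = some x then T.crossSign c i else 0) =
      T.ind x γ * (t.weight - t'.weight) := by
  by_cases hγ : x ∈ γ.1
  · rw [if_pos ⟨x, hγ, hx⟩, T.crossSign_eq hw hx (hy (T.opp_ne_of_mem hγ)) h rfl, ind, if_pos hγ,
      one_mul]
  · rw [if_neg, ind, if_neg hγ, zero_mul]
    rintro ⟨x', hx', h'⟩
    rw [hx, Option.some_inj] at h'
    exact hγ (h' ▸ hx')

-- The same for a curve read against its direction: the two turns are interchanged and flipped, and
-- the difference of weights is unchanged by this.
omit [DecidableEq D] in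
open Classical in
theorem shearTerm_eq_neg {c : ℤ → Option D} {i : ℤ} {w x : D} {t t' : Turn} {γ : T.Arc}
    (hw : c (i + 1) = some (T.opp w)) (hx : c i = some (T.opp x)) (h : x = T.exit t (T.opp w))
    (hy : T.opp x ≠ x → c (i - 1) = some (T.opp (T.exit t' (T.opp x)))) :
    (if ∃ x ∈ γ.1, c i = some x then T.crossSign c i else 0) =
      T.ind x γ * (t.weight - t'.weight) := by
  by_cases hγ : x ∈ γ.1
  · have hopp := T.mem_arc_opp.2 hγ
    rw [if_pos ⟨_, hopp, hx⟩, T.crossSign_eq (hy (T.opp_ne_of_mem hγ)) hx hw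
      (t := t'.flip) (t' := t.flip), ind, if_pos hγ, one_mul, Turn.weight_flip, Turn.weight_flip]
    · ring
    · rw [T.opp_opp, T.exit_flip_exit]
    · rw [T.opp_opp, h, T.exit_flip_exit]
  · rw [if_neg, ind, if_neg hγ, zero_mul]
    rintro ⟨x', hx', h'⟩
    rw [hx, Option.some_inj] at h'
    exact hγ (T.mem_arc_opp.1 (h' ▸ hx'))

theorem ray_eq_some_succ {d x : D} {t : ℕ → Turn} {n : ℕ} (h : T.ray d t (n + 1) = some x) :
    ∃ w, T.ray d t n = some w ∧ x = T.exit (t n) (T.opp w) := by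
  rw [ray, Option.bind_eq_some_iff] at h
  obtain ⟨w, hw, h⟩ := h
  refine ⟨w, hw, ?_⟩
  split_ifs at h
  exact (Option.some_inj.1 h).symm

theorem ray_succ {d x : D} {t : ℕ → Turn} {n : ℕ} (h : T.ray d t n = some x) (hx : T.opp x ≠ x) :
    T.ray d t (n + 1) = some (T.exit (t n) (T.opp x)) := by
  rw [ray, h, Option.bind_some, if_neg hx]

/-- The two rays leave a common triangle, in which the curve turns by `s.flip` or `s` according to
its direction. The sum over the integers splits into the sums along the two rays. -/
theorem shear_joinRays {d d' : D} {s : Turn} (hd : d' = T.exit s d) (t t' : ℕ → Turn) (γ : T.Arc)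
    {u v : ℤ} (hu : HasSum (T.rayTerm s.flip d t γ) u) (hv : HasSum (T.rayTerm s d' t' γ) v) :
    T.shear γ (T.joinRays (T.ray d t) (T.ray d' t')) = u + v := by
  classical
  have hd' : d = T.exit s.flip d' := by rw [hd, T.exit_flip_exit]
  have key : HasSum (fun i : ℤ => if ∃ x ∈ γ.1, T.joinRays (T.ray d t) (T.ray d' t') i = some x
      then T.crossSign (T.joinRays (T.ray d t) (T.ray d' t')) i else 0) (u + v) := by
    refine HasSum.of_nat_of_neg_add_one (hu.congr_fun fun n => ?_) (hv.congr_fun fun n => ?_)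
    · rcases n with _ | n
      · rw [T.shearTerm_eq (w := T.opp d') (x := d) (t := s.flip) (t' := t 0) rfl rfl
          (by rw [T.opp_opp, hd']) fun h => T.ray_succ rfl h]
        rfl
      · rcases hx : T.ray d t (n + 1) with _ | x
        · rw [if_neg, rayTerm, hx]
          · simp
          · rintro ⟨x, _, h⟩
            exact absurd (hx.symm.trans h) (by simp)
        · obtain ⟨w, hw, h⟩ := T.ray_eq_some_succ hx
          rw [T.shearTerm_eq (w := w) (x := x) (t := t n) (t' := t (n + 1)) _ hx h
            fun h => T.ray_succ hx h, rayTerm, hx]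
          · rfl
          · rw [← hw, Nat.cast_succ, add_sub_cancel_right]; rfl
    · have hneg : ∀ m : ℕ, T.joinRays (T.ray d t) (T.ray d' t') (-((m : ℤ) + 1)) =
          (T.ray d' t' m).map T.opp := fun m => by
        rw [← Int.negSucc_eq]; rfl
      rcases n with _ | n
      · rw [T.shearTerm_eq_neg (w := T.opp d) (x := d') (t := s) (t' := t' 0)]
        · rfl
        · simp only [T.opp_opp]; rfl
        · exact hneg 0
        · rw [T.opp_opp, hd]
        · intro h
          have := hneg 1
          rw [T.ray_succ rfl h] at this
          exact this
      · rcases hx : T.ray d' t' (n + 1) with _ | x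
        · rw [if_neg, rayTerm, hx]
          · simp
          · rintro ⟨x, _, h⟩
            rw [hneg, hx] at h
            simp at h
        · obtain ⟨w, hw, h⟩ := T.ray_eq_some_succ hx
          rw [T.shearTerm_eq_neg (w := w) (x := x) (t := t' n) (t' := t' (n + 1)) _ _ h, rayTerm,
            hx]
          · rfl
          · intro h
            have := hneg (n + 2)
            rw [T.ray_succ hx h] at this
            refine Eq.trans ?_ this
            congr 1
          · have := hneg n
            rw [hw] at this
            refine Eq.trans ?_ this
            congr 1
          · rw [hneg, hx]; rfl
  -- A summable family of integers has finite support, so the infinite sum is the `finsum` that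
  -- defines `shear`.
  exact (tsum_eq_finsum (L := .unconditional ℤ)
    (Summable.hasFiniteSupport_of_discreteTopology _ key.summable)).symm.trans key.tsum_eq

/-- The shear coordinates of a curve that is not close to an arc of the triangulation. -/
theorem shear_across {d : D} {ts : List Turn} (h : ∀ x ∈ T.crossFrom d ts, T.opp x ≠ x)
    (s e : Turn) (γ : T.Arc) :
    T.shear γ (T.curve (.across d ts) s e) = T.halfShear s.flip (T.opp d) ts e γ +
      (s.weight - s.flip.weight) * T.ind (T.exit s d) γ :=
  T.shear_joinRays rfl _ _ γ (T.hasSum_rayTerm_path s.flip d ts e γ h)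
    (T.hasSum_rayTerm_const s s.flip _ γ)

theorem shear_along_left_left (a : D) (γ : T.Arc) :
    T.shear γ (T.curve (.along a) .left .left) = -T.ind a γ := by
  have := T.shear_joinRays (d := T.next a) (d' := a) (s := .left) (T.next_next_next a).symm
    _ _ γ (T.hasSum_rayTerm_const _ .right _ γ) (T.hasSum_rayTerm_const _ .right _ γ)
  rw [curve, this]
  simp [Turn.flip, Turn.weight]

theorem shear_along_right_right (a : D) (γ : T.Arc) :
    T.shear γ (T.curve (.along a) .right .right) = T.ind a γ := by
  have := T.shear_joinRays (d := a) (d' := T.next (T.next a)) (s := .left) rfl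
    _ _ γ (T.hasSum_rayTerm_const _ .left _ γ) (T.hasSum_rayTerm_const _ .left _ γ)
  rw [curve, this]
  simp [Turn.flip, Turn.weight]

theorem shear_along_right_left (a : D) (γ : T.Arc) :
    T.shear γ (T.curve (.along a) .right .left) =
      T.ind (T.next (T.next a)) γ - T.ind (T.next a) γ := by
  have := T.shear_joinRays (d := T.next a) (d' := T.next (T.next a)) (s := .right) rfl
    _ _ γ (T.hasSum_rayTerm_const _ .right _ γ) (T.hasSum_rayTerm_const _ .left _ γ)
  rw [curve, this]
  simp [Turn.flip, Turn.weight]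
  ring

theorem shear_along_left_right (a : D) (γ : T.Arc) :
    T.shear γ (T.curve (.along a) .left .right) =
      T.ind (T.next (T.next (T.opp a))) γ - T.ind (T.next (T.opp a)) γ :=
  T.shear_along_right_left (T.opp a) γ

end

end Triangulation

namespace Triangulation

variable {D : Type*} (T : Triangulation D)

/-! ### Paths followed from the side through which they enter a triangle -/

/-- The sides crossed by a path that enters a triangle through `e` and then makes the turns `ts`
(without `e` itself). -/
def crossInto : D → List Turn → List D
  | _, [] => []
  | e, t :: ts => T.exit t e :: crossInto (T.opp (T.exit t e)) ts

/-- The side through which such a path enters its last triangle. -/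
def lastInto : D → List Turn → D
  | e, [] => e
  | e, t :: ts => lastInto (T.opp (T.exit t e)) ts

theorem crossFrom_eq (d : D) (ts : List Turn) :
    T.crossFrom d ts = d :: T.crossInto (T.opp d) ts := by
  induction ts generalizing d with
  | nil => rfl
  | cons t ts ih => rw [crossFrom, ih, crossInto]

theorem opp_lastCross (d : D) (ts : List Turn) :
    T.opp (T.lastCross d ts) = T.lastInto (T.opp d) ts := by
  induction ts generalizing d with
  | nil => rfl
  | cons t ts ih => rw [lastCross, ih, lastInto]

theorem endPt_across (d : D) (ts : List Turn) :
    T.endPt (.across d ts) = T.src (T.next (T.next (T.lastInto (T.opp d) ts))) := by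
  rw [endPt, opp_lastCross]

/-- Splitting the shear coordinates of a path at a crossing; the crossing can be moved. -/
theorem halfShear_move (g : D) (t : Turn) (fwd bwd : List Turn) (s e σ τ : Turn) :
    T.halfShear σ (T.opp g) (t :: fwd) e + T.halfShear σ.flip g bwd s =
      T.halfShear τ (T.opp (T.exit t (T.opp g))) fwd e +
        T.halfShear τ.flip (T.exit t (T.opp g)) (t.flip :: bwd) s := by
  have h1 := T.halfShear_sub σ t (T.opp g) (t :: fwd) e
  have h2 := T.halfShear_sub σ.flip t.flip g bwd s
  have h3 := T.halfShear_sub τ t (T.opp (T.exit t (T.opp g))) fwd e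
  have h4 := T.halfShear_sub τ.flip t.flip (T.exit t (T.opp g)) (t.flip :: bwd) s
  rw [sub_eq_iff_eq_add] at h1 h2 h3 h4
  rw [h1, h2, h3, h4]
  simp only [halfShear, exit_flip_exit, T.opp_opp, T.ind_opp, Turn.weight_flip]
  module

theorem halfShear_split (d : D) (ts₁ ts₂ acc : List Turn) (s e σ τ : Turn) :
    T.halfShear σ (T.opp d) (ts₁ ++ ts₂) e + T.halfShear σ.flip d acc s =
      T.halfShear τ (T.opp (T.lastCross d ts₁)) ts₂ e +
        T.halfShear τ.flip (T.lastCross d ts₁) (ts₁.reverse.map Turn.flip ++ acc) s := by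
  induction ts₁ generalizing d acc σ with
  | nil =>
    have h1 := T.halfShear_sub σ τ (T.opp d) ts₂ e
    have h2 := T.halfShear_sub σ.flip τ.flip d acc s
    rw [sub_eq_iff_eq_add] at h1 h2
    simp only [List.nil_append, List.reverse_nil, List.map_nil, lastCross]
    rw [h1, h2, T.ind_opp, Turn.weight_flip, Turn.weight_flip]
    module
  | cons t ts ih =>
    rw [List.cons_append, T.halfShear_move d t _ _ s e σ τ, ih]
    simp [lastCross]

variable [DecidableEq D]

theorem kappa_eq (α : TaggedArc D) :
    T.kappa α = T.curve α.path α.startTag.turn α.endTag.turn := by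
  obtain ⟨p, _ | _, _ | _⟩ := α <;> rfl

/-- The shear coordinates of a path, split at one of its crossings. -/
theorem shear_across_split {d : D} {ts₁ ts₂ : List Turn}
    (h : ∀ x ∈ T.crossFrom d (ts₁ ++ ts₂), T.opp x ≠ x) (s e σ : Turn) (γ : T.Arc) :
    T.shear γ (T.curve (.across d (ts₁ ++ ts₂)) s e) =
      T.halfShear σ (T.opp (T.lastCross d ts₁)) ts₂ e γ +
        T.halfShear σ.flip (T.lastCross d ts₁) (ts₁.reverse.map Turn.flip) s γ := by
  -- With no accumulated turns and the incoming turn `s.flip`, the backward half is just the initial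
  -- spiral.
  have key := congrFun (T.halfShear_split d ts₁ ts₂ [] s e s.flip σ) γ
  rw [List.append_nil, Pi.add_apply, Pi.add_apply] at key
  rw [T.shear_across h, ← key, T.halfShear_nil]
  simp

/-! ### Shear coordinates of the sides of the quadrilateral -/

open Classical in
/-- The shear coordinates of a side of the quadrilateral; boundary segments have none. -/
noncomputable def sideShear (β : TaggedArc D) (γ : T.Arc) : ℤ :=
  if ∃ a, β.path = .along a ∧ T.opp a = a then 0 else T.shear γ (T.kappa β)

theorem sideShear_across (d : D) (ts : List Turn) (s e : Tag) (γ : T.Arc) :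
    T.sideShear ⟨.across d ts, s, e⟩ γ = T.shear γ (T.curve (.across d ts) s.turn e.turn) := by
  rw [sideShear, if_neg (by simp), kappa_eq]

theorem sideShear_along_plain (a : D) (γ : T.Arc) :
    T.sideShear ⟨.along a, .plain, .plain⟩ γ = -T.ind a γ := by
  rw [sideShear]
  split_ifs with h
  · obtain ⟨b, hb, h⟩ := h
    cases hb
    rw [T.ind_boundary h]; simp
  · rw [kappa_eq]
    exact T.shear_along_left_left a γ

theorem sideShear_along_interior {a : D} (h : T.opp a ≠ a) (s e : Tag) (γ : T.Arc) :
    T.sideShear ⟨.along a, s, e⟩ γ = T.shear γ (T.curve (.along a) s.turn e.turn) := by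
  rw [sideShear, if_neg, kappa_eq]
  rintro ⟨b, hb, hb'⟩
  cases hb
  exact h hb'

/-- The sides at the endpoint of a path are arcs if the path is notched there. -/
def NotchInterior (e : D) (ts : List Turn) (tag : Tag) : Prop :=
  tag = .notched → ∀ s, T.opp (T.exit s (T.lastInto e ts)) ≠ T.exit s (T.lastInto e ts)

omit [DecidableEq D] in
@[simp] theorem weight_left : Turn.left.weight = 0 := rfl
omit [DecidableEq D] in
@[simp] theorem weight_right : Turn.right.weight = 1 := rfl

/-- The clockwise spiral at the left endpoint of `e` reaches the path by left turns, so `kappa` of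
this side behaves like a curve entering through `e` after a left turn. Initial left turns of the
path only prolong the spiral and contribute nothing. -/
theorem sideShear_leftSide {e : D} {ts : List Turn} {tag : Tag}
    (hint : ∀ x ∈ T.crossInto e ts, T.opp x ≠ x) (hend : T.NotchInterior e ts tag) (γ : T.Arc) :
    T.sideShear (T.leftSide e ts tag) γ = T.halfShear .left e ts tag.turn γ := by
  induction ts generalizing e with
  | nil =>
    rw [leftSide, T.halfShear_nil]
    cases tag with
    | plain =>
      rw [T.sideShear_along_plain]
      simp [Tag.turn, Turn.flip, exit]
    | notched =>
      rw [T.sideShear_along_interior (a := T.next (T.next e)) (hend rfl .left)]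
      simp only [Tag.turn]
      rw [T.shear_along_right_left]
      simp [Turn.flip, exit, T.next_next_next]
      ring
  | cons t ts ih =>
    cases t with
    | left =>
      rw [leftSide, T.halfShear_cons, ih (fun x hx => hint x (List.mem_cons_of_mem _ hx)) hend]
      simp
    | right =>
      have h : ∀ x ∈ T.crossFrom (T.exit .right e) ts, T.opp x ≠ x := by
        rw [T.crossFrom_eq]; exact hint
      rw [leftSide, T.sideShear_across, T.shear_across h, T.halfShear_cons]
      have : T.exit (Tag.plain.turn) (T.exit .right e) = e := T.next_next_next e
      rw [this]
      simp [Tag.turn, Turn.flip]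
      ring

/-- The sum over the corners of the triangle of `d` at the two ends of `d`. -/
noncomputable def cornerInd (d : D) (γ : T.Arc) : ℤ :=
  T.ind (T.next d) γ - T.ind (T.next (T.next d)) γ

/-- The arcs crossed by a path turning right around a vertex, as long as it does; and if it
ends there, being notched, also the next arc. -/
def fan : D → List Turn → Tag → List D
  | _, [], .plain => []
  | e, [], .notched => [T.next e]
  | e, .right :: ts, tag => T.exit .right e :: fan (T.opp (T.exit .right e)) ts tag
  | _, .left :: _, _ => []

/-- At the right endpoint the clockwise spiral runs on the far side and misses `e`. Where the path
turns left this changes the sum by `ind e + cornerInd e`. At a right turn the induction closes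
because `ind e + cornerInd e + cornerInd (next e) = ind (next e)` in every triangle. -/
theorem sideShear_rightSide {e : D} {ts : List Turn} {tag : Tag}
    (hint : ∀ x ∈ T.crossInto e ts, T.opp x ≠ x) (hend : T.NotchInterior e ts tag) (γ : T.Arc) :
    T.sideShear (T.rightSide e ts tag) γ = T.halfShear .right e ts tag.turn γ -
      (T.ind e γ + T.cornerInd e γ + ((T.fan e ts tag).map fun x =>
        T.cornerInd x γ + T.cornerInd (T.opp x) γ).sum) := by
  induction ts generalizing e with
  | nil =>
    rw [rightSide, T.halfShear_nil]
    cases tag with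
    | plain =>
      rw [T.sideShear_along_plain]
      simp [Tag.turn, Turn.flip, exit, cornerInd, fan]
      ring
    | notched =>
      rw [T.sideShear_along_interior (a := T.next e) (hend rfl .right)]
      simp only [Tag.turn]
      rw [T.shear_along_left_right]
      simp [Turn.flip, exit, cornerInd, fan, T.next_next_next]
      ring
  | cons t ts ih =>
    cases t with
    | right =>
      rw [rightSide, T.halfShear_cons, ih (fun x hx => hint x (List.mem_cons_of_mem _ hx)) hend,
        fan, List.map_cons, List.sum_cons, T.ind_opp]
      simp [cornerInd, exit, T.next_next_next]
      ring
    | left =>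
      have h : ∀ x ∈ T.crossFrom (T.exit .left e) ts, T.opp x ≠ x := by
        rw [T.crossFrom_eq]; exact hint
      have h' := congrFun (T.halfShear_sub .right .left (T.opp (T.exit .left e)) ts tag.turn) γ
      rw [Pi.sub_apply, sub_eq_iff_eq_add] at h'
      rw [rightSide, T.sideShear_across, T.shear_across h, T.halfShear_cons]
      simp only [Tag.turn] at h' ⊢
      simp only [Turn.flip, T.ind_opp] at h' ⊢
      rw [h']
      simp [cornerInd, fan, exit, T.next_next_next]
      ring

/-! ### Laurent monomials -/

omit [DecidableEq D] in
theorem prod_x_zpow [Fintype D] (f : T.Arc → ℤ) :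
    ∏ β : T.Arc, T.x β ^ f β = Multiplicative.ofAdd (Sum.elim f 0) := by
  classical
  apply Multiplicative.toAdd.injective
  rw [toAdd_prod, toAdd_ofAdd]
  funext i
  rw [Finset.sum_apply]
  rcases i with δ | δ
  · rw [Finset.sum_eq_single δ]
    · simp [x]
    · intro b _ hb
      simp [x, hb.symm]
    · simp
  · simp [x]

theorem g_eq [Fintype D] (α : TaggedArc D) : T.g α =
    Multiplicative.ofAdd (Sum.elim (fun γ => -T.shear γ (T.kappa α)) 0) :=
  T.prod_x_zpow _

open Classical in
theorem gProd_eq [Fintype D] (l : List (TaggedArc D)) : Exchange.gProd T l =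
    Multiplicative.ofAdd (Sum.elim (fun γ => -(l.map fun β => T.sideShear β γ).sum) 0) := by
  induction l with
  | nil =>
    apply Multiplicative.toAdd.injective
    funext i
    rcases i with δ | δ <;> simp [Exchange.gProd]
  | cons β l ih =>
    rw [Exchange.gProd, List.map_cons, List.prod_cons]
    rw [Exchange.gProd] at ih
    rw [ih, T.g_eq]
    apply Multiplicative.toAdd.injective
    funext i
    rcases i with δ | δ <;> by_cases h : ∃ a, β.path = .along a ∧ T.opp a = a <;>
      simp [sideShear, h]
    ring

omit [DecidableEq D] in
theorem adj_eq [Fintype D] (β γ : T.Arc) {d : D} (h : d ∈ γ.1) :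
    T.adj β γ = T.cornerInd d β + T.cornerInd (T.opp d) β := by
  classical
  have hne := T.opp_ne_of_mem h
  rw [adj, ← Finset.sum_subset (Finset.subset_univ {d, T.opp d}),
    Finset.sum_pair hne.symm, if_pos h, if_pos (T.mem_arc_opp.2 h)]
  · rfl
  · intro e _ he
    rw [if_neg]
    rw [T.arc_eq_pair h]
    simpa using he

end Triangulation

namespace Triangulation

variable {D : Type*} (T : Triangulation D)

/-! ### Elementary laminations that cross from left to left -/

theorem tgt_opp {d : D} (h : T.opp d ≠ d) : T.tgt (T.opp d) = T.src d :=
  (Quot.sound ⟨h, rfl⟩).symm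

theorem src_opp {d : D} (h : T.opp d ≠ d) : T.src (T.opp d) = T.tgt d := by
  rw [← T.tgt_opp (T.opp_opp_ne h), T.opp_opp]

theorem src_cw {d : D} (h : T.opp d ≠ d) : T.src (T.cw d) = T.src d :=
  T.tgt_opp h

/-- The vertex at which a path ends. -/
def endInto (e : D) (ts : List Turn) : T.Vertex := T.src (T.next (T.next (T.lastInto e ts)))

/-- A path that crosses arcs only, none of them ending at a vertex in `Rev`. -/
def Avoids (Rev : T.Vertex → Prop) (e : D) (ts : List Turn) : Prop :=
  ∀ x ∈ T.crossInto e ts, T.opp x ≠ x ∧ ¬ Rev (T.src x) ∧ ¬ Rev (T.tgt x)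

variable {T}

theorem Avoids.tail {Rev : T.Vertex → Prop} {e : D} {t : Turn} {ts : List Turn}
    (h : T.Avoids Rev e (t :: ts)) : T.Avoids Rev (T.opp (T.exit t e)) ts := fun x hx =>
  h x (List.mem_cons_of_mem _ hx)

theorem Avoids.head {Rev : T.Vertex → Prop} {e : D} {t : Turn} {ts : List Turn}
    (h : T.Avoids Rev e (t :: ts)) : T.opp (T.exit t e) ≠ T.exit t e ∧
      ¬ Rev (T.src (T.exit t e)) ∧ ¬ Rev (T.tgt (T.exit t e)) :=
  h _ List.mem_cons_self

variable (T)

/-- A curve that turns right cannot be departing to the left, so the path must make the same right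
turns, and the side reached by them belongs to its fan. -/
theorem fan_mem_of_departsLeft {g : D} {ts : List Turn} {tag : Tag} {q : ℕ → Option D} {j : ℕ}
    (hq : ∀ n ≤ j, q n = some (T.cw^[n + 1] g)) (h : T.DepartsLeft (T.opp g) ts q) :
    T.cw^[j + 1] g ∈ T.fan (T.opp g) ts tag := by
  have h0 : q 0 = some (T.exit .right (T.opp g)) := hq 0 j.zero_le
  have hne : q 0 ≠ some (T.exit .left (T.opp g)) := fun h' => by
    rw [h0, Option.some_inj] at h'
    exact absurd (T.exit_inj h') (by simp)
  induction ts generalizing g q j with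
  | nil => exact absurd h hne
  | cons t ts ih =>
    rcases h with ⟨_, h⟩ | ⟨h, h'⟩
    · exact absurd h hne
    · rw [h0, Option.some_inj] at h
      obtain rfl := T.exit_inj h.symm
      rw [fan]
      rcases j with _ | j
      · exact List.mem_cons_self
      · refine List.mem_cons_of_mem _ ?_
        have hq' : ∀ n ≤ j, q (n + 1) = some (T.cw^[n + 1] (T.cw g)) := fun n hn =>
          hq (n + 1) (by lia)
        have h1 : q (0 + 1) = some (T.exit .right (T.opp (T.cw g))) := hq' 0 j.zero_le
        refine ih hq' h' h1 fun h' => ?_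
        rw [h1, Option.some_inj] at h'
        exact absurd (T.exit_inj h') (by simp)

/-- After the common right turns, both exits of the triangle end at a vertex in `Rev`, where the
path crosses nothing. So the path ends in this triangle, notched, and the side in question is the
extra last member of the fan. -/
theorem fan_mem_of_departsLeft_mixed {Rev : T.Vertex → Prop} {g : D} {ts : List Turn} {tag : Tag}
    {q : ℕ → Option D} {j : ℕ} (hq : ∀ n < j, q n = some (T.cw^[n + 1] g))
    (hrev : Rev (T.tgt (T.next (T.opp (T.cw^[j] g))))) (hav : T.Avoids Rev (T.opp g) ts)
    (hend : Rev (T.endInto (T.opp g) ts) → tag = .notched) (h : T.DepartsLeft (T.opp g) ts q) :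
    T.next (T.opp (T.cw^[j] g)) ∈ T.fan (T.opp g) ts tag := by
  induction j generalizing g ts q with
  | zero =>
    cases ts with
    | nil =>
      obtain rfl := hend hrev
      exact List.mem_singleton_self _
    | cons t ts =>
      cases t with
      | right => exact absurd hrev hav.head.2.2
      | left => exact absurd hrev hav.head.2.1
  | succ j ih =>
    have h0 : q 0 = some (T.exit .right (T.opp g)) := hq 0 j.succ_pos
    have hne : q 0 ≠ some (T.exit .left (T.opp g)) := fun h' => by
      rw [h0, Option.some_inj] at h'
      exact absurd (T.exit_inj h') (by simp)
    cases ts with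
    | nil => exact absurd h hne
    | cons t ts =>
      rcases h with ⟨_, h⟩ | ⟨h, h'⟩
      · exact absurd h hne
      · rw [h0, Option.some_inj] at h
        obtain rfl := T.exit_inj h.symm
        rw [fan]
        exact List.mem_cons_of_mem _ (ih (g := T.cw g) (fun n hn => hq (n + 1) (by lia)) hrev
          hav.tail hend h')

section

variable [DecidableEq D]

/-- A curve that always turns left separates from the path at the first right turn of the path, or
at its end. -/
theorem departsLeft_ray_left {e : D} {ts : List Turn} (h : ∀ x ∈ T.crossInto e ts, T.opp x ≠ x) :
    T.DepartsLeft e ts (T.ray (T.exit .left e) fun _ => .left) := by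
  induction ts generalizing e with
  | nil => rfl
  | cons t ts ih =>
    cases t with
    | right => exact Or.inl ⟨rfl, rfl⟩
    | left =>
      refine Or.inr ⟨rfl, ?_⟩
      have h0 := h _ List.mem_cons_self
      have := ih fun x hx => h x (List.mem_cons_of_mem _ hx)
      convert this using 2 with n
      exact T.ray_succ_of_interior h0 _ n

open Classical in
/-- The elementary lamination of a side, with the spirals reversed at the vertices in `Rev`. -/
noncomputable def elementary (Rev : T.Vertex → Prop) (a : D) : ℤ → Option D :=
  T.curve (.along a) (if Rev (T.src a) then .left else .right)
    (if Rev (T.tgt a) then .left else .right)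

variable {T}

theorem elementary_of_not {Rev : T.Vertex → Prop} {a : D} (h : ¬ Rev (T.src a))
    (h' : ¬ Rev (T.tgt a)) : T.elementary Rev a =
      T.joinRays (T.ray a fun _ => .left) (T.ray (T.next (T.next a)) fun _ => .left) := by
  rw [elementary, if_neg h, if_neg h', curve]

theorem elementary_of_tgt {Rev : T.Vertex → Prop} {a : D} (h : ¬ Rev (T.src a))
    (h' : Rev (T.tgt a)) : T.elementary Rev a =
      T.joinRays (T.ray (T.next a) fun _ => .right) (T.ray (T.next (T.next a)) fun _ => .left) := by
  rw [elementary, if_neg h, if_pos h', curve]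

theorem elementary_of_src {Rev : T.Vertex → Prop} {a : D} (h : Rev (T.src a))
    (h' : ¬ Rev (T.tgt a)) (ha : T.opp a ≠ a) :
    T.elementary Rev a = T.elementary Rev (T.opp a) := by
  rw [elementary_of_tgt (a := T.opp a) (by rwa [T.src_opp ha]) (by rwa [T.tgt_opp ha]),
    elementary, if_pos h,
    if_neg h', curve]

theorem elementary_of_both {Rev : T.Vertex → Prop} {a : D} (h : Rev (T.src a))
    (h' : Rev (T.tgt a)) : T.elementary Rev a =
      T.joinRays (T.ray (T.next a) fun _ => .right) (T.ray a fun _ => .right) := by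
  rw [elementary, if_pos h, if_pos h', curve]

variable (T)

/-- The curve `c` crosses `g` at the place `i`, then departs to the left of the path that goes on
with the turns `ts`, and it turns left all the time before, when followed backwards. -/
def ComesFromLeft (c : ℤ → Option D) (i : ℤ) (g : D) (ts : List Turn) : Prop :=
  c i = some g ∧ T.DepartsLeft (T.opp g) ts (fun n => c (i + 1 + n)) ∧
    ∀ n : ℕ, (c (i - 1 - n)).map T.opp = T.ray (T.exit .left g) (fun _ => .left) n

omit [DecidableEq D] in
theorem joinRays_cast (r₁ r₂ : ℕ → Option D) (n : ℕ) : T.joinRays r₁ r₂ n = r₁ n := rfl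

omit [DecidableEq D] in
theorem joinRays_neg (r₁ r₂ : ℕ → Option D) (n : ℕ) :
    T.joinRays r₁ r₂ (-1 - n) = (r₂ n).map T.opp := by
  have : (-1 - n : ℤ) = Int.negSucc n := by rw [Int.negSucc_eq]; ring
  rw [this]; rfl

omit [DecidableEq D] in
theorem map_opp_map_opp (o : Option D) : (o.map T.opp).map T.opp = o := by
  cases o <;> simp [T.opp_opp]

variable {T}

theorem comesFromLeft_self {Rev : T.Vertex → Prop} {g : D} {ts : List Turn}
    (hg : T.opp g ≠ g ∧ ¬ Rev (T.src g) ∧ ¬ Rev (T.tgt g)) (hav : T.Avoids Rev (T.opp g) ts) :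
    T.ComesFromLeft (T.elementary Rev g) 0 g ts := by
  rw [elementary_of_not hg.2.1 hg.2.2]
  refine ⟨rfl, ?_, fun n => ?_⟩
  · convert T.departsLeft_ray_left fun x hx => (hav x hx).1 using 2 with n
    rw [show (0 + 1 + n : ℤ) = ((n + 1 : ℕ) : ℤ) by push_cast; ring, joinRays_cast,
      T.ray_succ_of_interior hg.1]
  · rw [zero_sub, joinRays_neg, map_opp_map_opp]
    rfl

/-- The curve already crosses `g` if it crosses the next side reached by a right turn. -/
theorem ComesFromLeft.prev {c : ℤ → Option D} {i : ℤ} {g : D} {ts : List Turn}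
    (hg : T.opp g ≠ g) (h : T.ComesFromLeft c i (T.exit .right (T.opp g)) ts) :
    T.ComesFromLeft c (i - 1) g (.right :: ts) := by
  obtain ⟨h1, h2, h3⟩ := h
  have hx : T.exit .left (T.exit .right (T.opp g)) = T.opp g := T.exit_flip_exit .right _
  rw [hx] at h3
  refine ⟨?_, Or.inr ⟨?_, ?_⟩, fun n => ?_⟩
  · have := congrArg (Option.map T.opp) (h3 0)
    rw [map_opp_map_opp] at this
    simpa [ray, T.opp_opp] using this
  · simpa using h1
  · convert h2 using 3 with n
    push_cast; ring
  · have := h3 (n + 1)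
    rw [T.ray_succ_of_interior (T.opp_opp_ne hg), T.opp_opp] at this
    rw [← this]
    congr 2
    push_cast; ring

/-- The lamination of a fan member spirals around the common vertex of the fan, so backwards it
crosses all earlier members down to `g`, by left turns. -/
theorem exists_comesFromLeft {Rev : T.Vertex → Prop} {g x : D} {ts : List Turn} {tag : Tag}
    (hg : T.opp g ≠ g ∧ ¬ Rev (T.src g) ∧ ¬ Rev (T.tgt g)) (hav : T.Avoids Rev (T.opp g) ts)
    (hend : tag = .notched → Rev (T.endInto (T.opp g) ts)) (hx : x ∈ T.fan (T.opp g) ts tag) :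
    ∃ i, T.ComesFromLeft (T.elementary Rev x) i g ts := by
  induction ts generalizing g with
  | nil =>
    cases tag with
    | plain => simp [fan] at hx
    | notched =>
      rw [fan, List.mem_singleton] at hx
      subst hx
      have hs : ¬ Rev (T.src (T.next (T.opp g))) := by
        rw [← tgt, T.tgt_opp hg.1]; exact hg.2.1
      -- A lamination with one reversed spiral does not cross its own side. The place `-1` is the
      -- first crossing of the unreversed spiral, and it is at `g`.
      refine ⟨-1, ?_⟩
      rw [elementary_of_tgt hs (hend rfl)]
      refine ⟨?_, ?_, fun n => ?_⟩
      · have := T.joinRays_neg (T.ray (T.next (T.next (T.opp g))) fun _ => .right)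
          (T.ray (T.next (T.next (T.next (T.opp g)))) fun _ => .left) 0
        rw [Nat.cast_zero, sub_zero] at this
        rw [this, T.next_next_next]
        simp [ray, T.opp_opp]
      · rfl
      · rw [show (-1 - 1 - n : ℤ) = -1 - (n + 1 : ℕ) by push_cast; ring, joinRays_neg,
          map_opp_map_opp, T.next_next_next, T.ray_succ_of_interior (T.opp_opp_ne hg.1), T.opp_opp]
  | cons t ts ih =>
    cases t with
    | left => simp [fan] at hx
    | right =>
      rw [fan, List.mem_cons] at hx
      rcases hx with rfl | hx
      · exact ⟨_, (comesFromLeft_self hav.head hav.tail).prev hg.1⟩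
      · obtain ⟨i, hi⟩ := ih hav.head hav.tail hend hx
        exact ⟨_, hi.prev hg.1⟩

variable (T)

/-- Followed backwards, left turns become right turns, which are clockwise steps `cw` about a fixed
vertex. -/
theorem ray_left_back {d y : D} {n : ℕ} (h : T.ray d (fun _ => .left) n = some y) {k : ℕ}
    (hk : k ≤ n) : T.ray d (fun _ => .left) (n - k) = some (T.opp (T.cw^[k] (T.opp y))) := by
  induction k with
  | zero => simpa [T.opp_opp] using h
  | succ k ih =>
    have h' := ih (by lia)
    rw [show n - k = n - (k + 1) + 1 by lia] at h'
    obtain ⟨w, hw, hw'⟩ := T.ray_eq_some_succ h'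
    rw [hw, Function.iterate_succ_apply', cw, hw']
    have : T.next (T.exit .left (T.opp w)) = T.opp w := T.exit_exit_flip .right _
    rw [this, T.opp_opp]

theorem src_ray_right {d y : D} {n : ℕ} (h : T.ray d (fun _ => .right) n = some y) :
    T.src y = T.src d := by
  induction n generalizing y with
  | zero => simp only [ray, Option.some_inj] at h; rw [h]
  | succ n ih =>
    have h' := h
    rw [ray, Option.bind_eq_some_iff] at h'
    obtain ⟨w, hw, h'⟩ := h'
    split_ifs at h' with hb
    rw [← Option.some_inj.1 h', ← ih hw]
    exact T.src_cw hb

variable {T}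

/-- If an elementary lamination with a spiral that is reversed at the end only crosses `g`, then
before the crossings at the start. -/
theorem mem_fan_of_mixed {Rev : T.Vertex → Prop} {g a : D} {ts : List Turn} {tag : Tag} {i : ℤ}
    (hg : ¬ Rev (T.src g)) (hav : T.Avoids Rev (T.opp g) ts)
    (hend : Rev (T.endInto (T.opp g) ts) → tag = .notched)
    (h : ¬ Rev (T.src a)) (h' : Rev (T.tgt a)) (hi : T.elementary Rev a i = some g)
    (hdep : T.DepartsLeft (T.opp g) ts (fun n => T.elementary Rev a (i + 1 + n))) :
    a ∈ T.fan (T.opp g) ts tag := by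
  rw [elementary_of_tgt h h'] at hi hdep
  rcases i with m | m
  -- From place 0 on, the curve spirals around the reversed endpoint of `a`, which would then be the
  -- starting point of `g`.
  · refine absurd h' ?_
    have := T.src_ray_right hi
    rwa [tgt, ← this]
  · have hi' : (T.ray (T.next (T.next a)) (fun _ => .left) m).map T.opp = some g := hi
    rw [Option.map_eq_some_iff] at hi'
    obtain ⟨z, hz, rfl⟩ := hi'
    have key : T.next (T.opp (T.cw^[m] (T.opp z))) = a := by
      have := T.ray_left_back hz le_rfl
      rw [Nat.sub_self, ray, Option.some_inj] at this
      rw [← this, T.next_next_next]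
    have := T.fan_mem_of_departsLeft_mixed (j := m) (g := T.opp z) (fun n hn => ?_)
      (by rwa [key]) hav hend hdep
    · rwa [key] at this
    · rw [show (Int.negSucc m + 1 + n : ℤ) = -1 - (m - (n + 1) : ℕ) by
        rw [Int.negSucc_eq]; lia,
        joinRays_neg, T.ray_left_back hz hn]
      simp [T.opp_opp]

/-- The spirals go around the two endpoints of `a`, and `g` has no endpoint in `Rev`. So `g` is
crossed at `a` itself or on an unreversed spiral; then the path on the side towards `a` has to turn
along with the lamination until `a` is reached. -/
theorem mem_of_departsLeft {Rev : T.Vertex → Prop} {g a : D} {fwd bwd : List Turn} {tf tb : Tag}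
    {i : ℤ} (hg : T.opp g ≠ g ∧ ¬ Rev (T.src g) ∧ ¬ Rev (T.tgt g))
    (hav : T.Avoids Rev (T.opp g) fwd) (hend : Rev (T.endInto (T.opp g) fwd) → tf = .notched)
    (ha : T.opp a ≠ a) (hi : T.elementary Rev a i = some g)
    (hf : T.DepartsLeft (T.opp g) fwd (fun n => T.elementary Rev a (i + 1 + n)))
    (hb : T.DepartsLeft g bwd (fun n => (T.elementary Rev a (i - 1 - n)).map T.opp)) :
    ∃ x ∈ g :: (T.fan (T.opp g) fwd tf ++ T.fan g bwd tb), x = a ∨ x = T.opp a := by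
  by_cases h : Rev (T.src a) <;> by_cases h' : Rev (T.tgt a)
  -- With both spirals reversed, every side that is crossed has an endpoint in `Rev`.
  · rw [elementary_of_both h h'] at hi
    rcases i with m | m
    · refine absurd h' ?_
      rw [tgt, ← T.src_ray_right hi]
      exact hg.2.1
    · refine absurd h ?_
      have hi' : (T.ray a (fun _ => .right) m).map T.opp = some g := hi
      rw [Option.map_eq_some_iff] at hi'
      obtain ⟨z, hz, rfl⟩ := hi'
      rw [← T.src_ray_right hz, ← T.tgt_opp (fun h => hg.1 (by rw [h, h]))]
      exact hg.2.2
  · rw [elementary_of_src h h' ha] at hi hf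
    have := mem_fan_of_mixed hg.2.1 hav hend (by rwa [T.src_opp ha]) (by rwa [T.tgt_opp ha]) hi hf
    exact ⟨_, by simp [this], Or.inr rfl⟩
  · have := mem_fan_of_mixed hg.2.1 hav hend h h' hi hf
    exact ⟨_, by simp [this], Or.inl rfl⟩
  · rw [elementary_of_not h h'] at hi hf hb
    rcases i with (_ | m) | m
    · exact ⟨g, List.mem_cons_self, Or.inl (Option.some_inj.1 hi).symm⟩
    -- Here `a` was crossed before `g`, so it lies in the backward fan; at negative places it comes
    -- after `g` and lies in the forward fan.
    · have hi' : T.ray a (fun _ => .left) (m + 1) = some g := hi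
      have key : T.cw^[m + 1] (T.opp g) = T.opp a := by
        have := T.ray_left_back hi' le_rfl
        rw [Nat.sub_self, ray, Option.some_inj] at this
        rw [this, T.opp_opp]
      have := T.fan_mem_of_departsLeft (j := m) (g := T.opp g) (tag := tb) (ts := bwd) ?_
        (by rw [T.opp_opp]; exact hb)
      · rw [key, T.opp_opp] at this
        exact ⟨_, by simp [this], Or.inr rfl⟩
      · intro n hn
        rw [show (Int.ofNat (m + 1) - 1 - n : ℤ) = (m + 1 - (n + 1) : ℕ) by
          rw [Int.ofNat_eq_natCast]; lia,
          joinRays_cast, T.ray_left_back hi' (by lia)]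
        simp [T.opp_opp]
    · have hi' : (T.ray (T.next (T.next a)) (fun _ => .left) m).map T.opp = some g := hi
      rw [Option.map_eq_some_iff] at hi'
      obtain ⟨z, hz, rfl⟩ := hi'
      have key : T.cw^[m + 1] (T.opp z) = a := by
        have := T.ray_left_back hz le_rfl
        rw [Nat.sub_self, ray, Option.some_inj] at this
        rw [Function.iterate_succ_apply', cw, ← this, T.next_next_next]
      have := T.fan_mem_of_departsLeft (j := m) (g := T.opp z) (tag := tf) ?_ hf
      · rw [key] at this
        exact ⟨_, by simp [this], Or.inl rfl⟩
      · intro n hn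
        rcases hn.lt_or_eq with hn | rfl
        · rw [show (Int.negSucc m + 1 + n : ℤ) = -1 - (m - (n + 1) : ℕ) by
            rw [Int.negSucc_eq]; lia,
            joinRays_neg, T.ray_left_back hz hn]
          simp [T.opp_opp]
        · rw [show (Int.negSucc n + 1 + n : ℤ) = (0 : ℕ) by
            rw [Int.negSucc_eq]; push_cast; ring, joinRays_cast, key]
          rfl

end

end Triangulation

namespace Triangulation

variable {D : Type*} (T : Triangulation D)

/-! ### The arcs that cross from left to left -/

/-- The two directions of a side. -/
def edge (d : D) : Set D := {d, T.opp d}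

theorem edge_opp (d : D) : T.edge (T.opp d) = T.edge d := by
  rw [edge, edge, T.opp_opp, Set.pair_comm]

theorem edge_eq_iff {d d' : D} : T.edge d = T.edge d' ↔ d = d' ∨ d = T.opp d' := by
  constructor
  · intro h
    have : d ∈ T.edge d' := h ▸ Or.inl rfl
    exact this
  · rintro (rfl | rfl)
    · rfl
    · exact T.edge_opp d'

theorem mem_arc_iff {γ : T.Arc} {d : D} : d ∈ γ.1 ↔ γ.1 = T.edge d :=
  ⟨fun h => T.arc_eq_pair h, fun h => h ▸ Or.inl rfl⟩

variable {T}

theorem fan_sublist (e : D) (ts : List Turn) : (T.fan e ts .plain).Sublist (T.crossInto e ts) := by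
  induction ts generalizing e with
  | nil => exact List.nil_sublist _
  | cons t ts ih =>
    cases t with
    | left => exact List.nil_sublist _
    | right => exact (ih _).cons_cons _

theorem fan_eq_append (e : D) (ts : List Turn) (tag : Tag) :
    T.fan e ts tag = T.fan e ts .plain ∨ tag = .notched ∧
      T.fan e ts tag = T.fan e ts .plain ++ [T.exit .right (T.lastInto e ts)] := by
  cases tag with
  | plain => exact Or.inl rfl
  | notched =>
    induction ts generalizing e with
    | nil => exact Or.inr ⟨rfl, rfl⟩
    | cons t ts ih =>
      cases t with
      | left => exact Or.inl rfl
      | right =>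
        rcases ih (T.opp (T.exit .right e)) with h | ⟨h', h⟩
        · left; rw [fan, h, fan]
        · right
          refine ⟨rfl, ?_⟩
          rw [fan, h, fan, List.cons_append, lastInto]

theorem src_of_mem_fan {Rev : T.Vertex → Prop} {e x : D} {ts : List Turn} {tag : Tag}
    (hav : T.Avoids Rev e ts) (hx : x ∈ T.fan e ts tag) : T.src x = T.tgt e := by
  induction ts generalizing e with
  | nil =>
    cases tag with
    | plain => simp [fan] at hx
    | notched =>
      rw [fan, List.mem_singleton] at hx
      rw [hx]; rfl
  | cons t ts ih =>
    cases t with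
    | left => simp [fan] at hx
    | right =>
      rw [fan, List.mem_cons] at hx
      rcases hx with rfl | hx
      · rfl
      · rw [ih hav.tail hx, T.tgt_opp hav.head.1]; rfl

variable (T)

/-! ### Curves with a quadrilateral, and their orange arcs -/

/-- The data of a curve that crosses `g`, up to its two ends where it is tagged `tf` and `tb`. The
vertices in `Rev` are at most its ends, namely those where it is notched. -/
structure IsExchangeCurve (Rev : T.Vertex → Prop) (g : D) (fwd bwd : List Turn)
    (tf tb : Tag) : Prop where
  cross : T.opp g ≠ g ∧ ¬ Rev (T.src g) ∧ ¬ Rev (T.tgt g)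
  avoids_fwd : T.Avoids Rev (T.opp g) fwd
  avoids_bwd : T.Avoids Rev g bwd
  end_fwd : Rev (T.endInto (T.opp g) fwd) ↔ tf = .notched
  end_bwd : Rev (T.endInto g bwd) ↔ tb = .notched
  interior_fwd : T.NotchInterior (T.opp g) fwd tf
  interior_bwd : T.NotchInterior g bwd tb
  src_ne_tgt : T.src g ≠ T.tgt g
  nodup : ((g :: (T.fan (T.opp g) fwd .plain ++ T.fan g bwd .plain)).map T.edge).Nodup

/-- The sides of the orange arcs. -/
def orangeSides (g : D) (fwd bwd : List Turn) (tf tb : Tag) : List D :=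
  g :: (T.fan (T.opp g) fwd tf ++ T.fan g bwd tb)

namespace IsExchangeCurve

variable {T} {Rev : T.Vertex → Prop} {g : D} {fwd bwd : List Turn} {tf tb : Tag}
  (h : T.IsExchangeCurve Rev g fwd bwd tf tb)
include h

theorem fan_interior_fwd : ∀ x ∈ T.fan (T.opp g) fwd tf, T.opp x ≠ x := by
  intro x hx
  rcases fan_eq_append (T := T) (T.opp g) fwd tf with h' | ⟨h', h''⟩
  · rw [h'] at hx
    exact (h.avoids_fwd x ((fan_sublist _ _).subset hx)).1
  · rw [h'', List.mem_append, List.mem_singleton] at hx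
    rcases hx with hx | rfl
    · exact (h.avoids_fwd x ((fan_sublist _ _).subset hx)).1
    · exact h.interior_fwd h' .right

theorem fan_interior_bwd : ∀ x ∈ T.fan g bwd tb, T.opp x ≠ x := by
  intro x hx
  rcases fan_eq_append (T := T) g bwd tb with h' | ⟨h', h''⟩
  · rw [h'] at hx
    exact (h.avoids_bwd x ((fan_sublist _ _).subset hx)).1
  · rw [h'', List.mem_append, List.mem_singleton] at hx
    rcases hx with hx | rfl
    · exact (h.avoids_bwd x ((fan_sublist _ _).subset hx)).1
    · exact h.interior_bwd h' .right

theorem orangeSides_interior : ∀ x ∈ T.orangeSides g fwd bwd tf tb, T.opp x ≠ x := by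
  intro x hx
  rw [orangeSides, List.mem_cons, List.mem_append] at hx
  rcases hx with rfl | hx | hx
  · exact h.cross.1
  · exact h.fan_interior_fwd x hx
  · exact h.fan_interior_bwd x hx

/-- The extra arcs at notched ends have an endpoint in `Rev`, unlike `g` and the arcs crossed. They
differ from each other because their other endpoints are the two distinct endpoints of `g`, neither
of which is in `Rev`. -/
theorem orangeSides_nodup : ((T.orangeSides g fwd bwd tf tb).map T.edge).Nodup := by
  have hcross : ∀ z ∈ g :: (T.fan (T.opp g) fwd .plain ++ T.fan g bwd .plain),
      T.opp z ≠ z ∧ ¬ Rev (T.src z) ∧ ¬ Rev (T.tgt z) := by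
    intro z hz
    rw [List.mem_cons, List.mem_append] at hz
    rcases hz with rfl | hz | hz
    · exact h.cross
    · exact h.avoids_fwd z ((fan_sublist _ _).subset hz)
    · exact h.avoids_bwd z ((fan_sublist _ _).subset hz)
  have hne : ∀ x z, Rev (T.tgt x) → T.opp z ≠ z ∧ ¬ Rev (T.src z) ∧ ¬ Rev (T.tgt z) →
      T.edge z ≠ T.edge x := by
    intro x z hx hz he
    rcases T.edge_eq_iff.1 he.symm with rfl | rfl
    · exact hz.2.2 hx
    · exact hz.2.1 (T.tgt_opp hz.1 ▸ hx)
  obtain ⟨A, hA, hA'⟩ : ∃ A, T.fan (T.opp g) fwd tf = T.fan (T.opp g) fwd .plain ++ A ∧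
      (A = [] ∨ ∃ x, A = [x] ∧ Rev (T.tgt x) ∧ T.src x = T.src g) := by
    rcases fan_eq_append (T := T) (T.opp g) fwd tf with h' | ⟨h', h''⟩
    · exact ⟨[], by simp [h'], Or.inl rfl⟩
    · refine ⟨_, h'', Or.inr ⟨_, rfl, h.end_fwd.2 h', ?_⟩⟩
      rw [src_of_mem_fan h.avoids_fwd (x := T.exit .right _) (tag := tf) (by rw [h'']; simp),
        T.tgt_opp h.cross.1]
  obtain ⟨B, hB, hB'⟩ : ∃ B, T.fan g bwd tb = T.fan g bwd .plain ++ B ∧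
      (B = [] ∨ ∃ x, B = [x] ∧ Rev (T.tgt x) ∧ T.src x = T.tgt g) := by
    rcases fan_eq_append (T := T) g bwd tb with h' | ⟨h', h''⟩
    · exact ⟨[], by simp [h'], Or.inl rfl⟩
    · refine ⟨_, h'', Or.inr ⟨_, rfl, h.end_bwd.2 h', ?_⟩⟩
      rw [src_of_mem_fan h.avoids_bwd (x := T.exit .right _) (tag := tb) (by rw [h'']; simp)]
  have hperm : (T.orangeSides g fwd bwd tf tb).Perm
      ((g :: (T.fan (T.opp g) fwd .plain ++ T.fan g bwd .plain)) ++ (A ++ B)) := by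
    rw [orangeSides, hA, hB, List.cons_append]
    refine List.Perm.cons _ ?_
    rw [List.append_assoc, List.append_assoc]
    refine List.Perm.append_left _ ?_
    rw [← List.append_assoc, ← List.append_assoc]
    exact List.Perm.append_right _ List.perm_append_comm
  rw [(hperm.map T.edge).nodup_iff, List.map_append, List.nodup_append]
  refine ⟨h.nodup, ?_, ?_⟩
  · rcases hA' with rfl | ⟨x, rfl, hx, hx'⟩ <;> rcases hB' with rfl | ⟨y, rfl, hy, hy'⟩
    · simp
    · simp
    · simp
    · simp only [List.singleton_append, List.map_cons, List.map_nil, List.nodup_cons,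
        List.mem_singleton, List.not_mem_nil, not_false_iff, List.nodup_nil, and_true]
      intro he
      rcases T.edge_eq_iff.1 he with rfl | rfl
      · exact h.src_ne_tgt (hx'.symm.trans hy')
      · by_cases hi : T.opp y = y
        · rw [hi] at hx'
          exact h.src_ne_tgt (hx'.symm.trans hy')
        · rw [T.tgt_opp hi, hy'] at hx
          exact h.cross.2.2 hx
  · intro e he e' he'
    obtain ⟨z, hz, rfl⟩ := List.mem_map.1 he
    obtain ⟨x, hx, rfl⟩ := List.mem_map.1 he'
    refine hne x z ?_ (hcross z hz)
    rw [List.mem_append] at hx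
    rcases hx with hx | hx
    · rcases hA' with rfl | ⟨y, rfl, hy, -⟩
      · simp at hx
      · rw [List.mem_singleton] at hx; rwa [hx]
    · rcases hB' with rfl | ⟨y, rfl, hy, -⟩
      · simp at hx
      · rw [List.mem_singleton] at hx; rwa [hx]

theorem exists_crossesLeftLeft_iff [DecidableEq D] (δ : T.Arc) :
    (∃ a ∈ δ.1, T.CrossesLeftLeft ⟨g, fwd, bwd⟩ (T.elementary Rev a)) ↔
      ∃ x ∈ T.orangeSides g fwd bwd tf tb, x ∈ δ.1 := by
  have hcross' : T.opp (T.opp g) ≠ T.opp g ∧ ¬ Rev (T.src (T.opp g)) ∧ ¬ Rev (T.tgt (T.opp g)) := by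
    rw [T.src_opp h.cross.1, T.tgt_opp h.cross.1]
    exact ⟨T.opp_opp_ne h.cross.1, h.cross.2.2, h.cross.2.1⟩
  have hav' : T.Avoids Rev (T.opp (T.opp g)) bwd := by rw [T.opp_opp]; exact h.avoids_bwd
  constructor
  · rintro ⟨a, ha, i, ⟨hi, hf, hb⟩ | ⟨hi, hf, hb⟩⟩
    · obtain ⟨x, hx, rfl | rfl⟩ := mem_of_departsLeft h.cross h.avoids_fwd h.end_fwd.1
        (T.opp_ne_of_mem ha) hi hf (tb := tb) hb
      · exact ⟨x, hx, ha⟩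
      · exact ⟨_, hx, T.mem_arc_opp.2 ha⟩
    -- The lamination crosses `g` the other way: the same situation with `g` reversed and the two
    -- halves interchanged.
    · have := mem_of_departsLeft (g := T.opp g) (fwd := bwd) (tf := tb) hcross' hav'
        (by rw [T.opp_opp]; exact h.end_bwd.1) (T.opp_ne_of_mem ha) hi
        (by rw [T.opp_opp]; exact hf) (tb := tf) hb
      rw [T.opp_opp] at this
      obtain ⟨x, hx, hxa⟩ := this
      have hx' : x ∈ δ.1 := by
        rcases hxa with rfl | rfl
        · exact ha
        · exact T.mem_arc_opp.2 ha
      rw [List.mem_cons, List.mem_append] at hx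
      rcases hx with rfl | hx | hx
      · exact ⟨g, List.mem_cons_self, T.mem_arc_opp.1 hx'⟩
      · exact ⟨x, by simp [orangeSides, hx], hx'⟩
      · exact ⟨x, by simp [orangeSides, hx], hx'⟩
  · rintro ⟨x, hx, hxδ⟩
    refine ⟨x, hxδ, ?_⟩
    have key : ∀ i, T.ComesFromLeft (T.elementary Rev x) i g fwd →
        T.CrossesLeftLeft ⟨g, fwd, bwd⟩ (T.elementary Rev x) := by
      rintro i ⟨h1, h2, h3⟩
      refine ⟨i, Or.inl ⟨h1, h2, ?_⟩⟩
      rw [funext h3]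
      exact T.departsLeft_ray_left fun x hx => (h.avoids_bwd x hx).1
    rw [orangeSides, List.mem_cons, List.mem_append] at hx
    rcases hx with rfl | hx | hx
    · exact key 0 (comesFromLeft_self h.cross h.avoids_fwd)
    · obtain ⟨i, hi⟩ := exists_comesFromLeft h.cross h.avoids_fwd h.end_fwd.2 hx
      exact key i hi
    · have : ∃ i, T.ComesFromLeft (T.elementary Rev x) i (T.opp g) bwd := by
        refine exists_comesFromLeft (tag := tb) hcross' hav' ?_ ?_
        · rw [T.opp_opp]; exact h.end_bwd.2
        · rwa [T.opp_opp]
      obtain ⟨i, h1, h2, h3⟩ := this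
      rw [T.opp_opp] at h2
      refine ⟨i, Or.inr ⟨h1, h2, ?_⟩⟩
      rw [funext h3]
      exact T.departsLeft_ray_left fun x hx => (h.avoids_fwd x hx).1

end IsExchangeCurve

/-! ### The exponent vector of the orange monomial -/

open Classical in
theorem sum_adj_of_nodup [Fintype D] (l : List D) (hl : (l.map T.edge).Nodup)
    (hint : ∀ x ∈ l, T.opp x ≠ x) (β : T.Arc) :
    ∑ δ : T.Arc, (if ∃ x ∈ l, x ∈ δ.1 then T.adj β δ else 0) =
      (l.map fun x => T.cornerInd x β + T.cornerInd (T.opp x) β).sum := by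
  induction l with
  | nil => simp
  | cons y l ih =>
    rw [List.map_cons, List.nodup_cons] at hl
    have hy := hint y List.mem_cons_self
    have hmem := T.mem_arcOf y hy
    rw [List.map_cons, List.sum_cons, ← T.adj_eq β (T.arcOf y hy) hmem,
      ← ih hl.2 fun x hx => hint x (List.mem_cons_of_mem _ hx)]
    rw [← Finset.sum_erase_add _ _ (Finset.mem_univ (T.arcOf y hy)),
      ← Finset.sum_erase_add (f := fun δ => if ∃ x ∈ l, x ∈ δ.1 then T.adj β δ else 0) _
        (Finset.mem_univ (T.arcOf y hy)),
      if_pos ⟨y, List.mem_cons_self, hmem⟩, if_neg, add_zero, add_comm]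
    · congr 1
      refine Finset.sum_congr rfl fun δ hδ => ?_
      refine if_congr ?_ rfl rfl
      simp only [List.mem_cons, exists_eq_or_imp, or_iff_right_iff_imp]
      exact fun h => absurd (T.arc_eq_of_mem h hmem) (Finset.ne_of_mem_erase hδ)
    · rintro ⟨x, hx, hx'⟩
      rw [T.mem_arc_iff] at hx' hmem
      exact hl.1 (List.mem_map.2 ⟨x, hx, hx'.symm.trans hmem⟩)

open Classical in
theorem setYOne_prod_yhat [Fintype D] (P : T.Arc → Prop) :
    T.setYOne (∏ δ : T.Arc, if P δ then T.yhat δ else 1) = Multiplicative.ofAdd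
      (Sum.elim (fun β => ∑ δ : T.Arc, if P δ then T.adj β δ else 0) 0) := by
  rw [map_prod]
  apply Multiplicative.toAdd.injective
  rw [toAdd_prod, toAdd_ofAdd]
  funext i
  rw [Finset.sum_apply]
  rcases i with β | β
  · refine Finset.sum_congr rfl fun δ _ => ?_
    by_cases h : P δ <;> simp [h, yhat, prod_x_zpow, setYOne, y]
  · refine Finset.sum_eq_zero fun δ _ => ?_
    simp [setYOne]

theorem x_eq {γ : T.Arc} {d : D} (h : d ∈ γ.1) :
    T.x γ = Multiplicative.ofAdd (Sum.elim (T.ind d) 0) := by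
  classical
  apply Multiplicative.toAdd.injective
  rw [x, toAdd_ofAdd, toAdd_ofAdd]
  funext i
  rcases i with β | β
  · simp only [Sum.elim_inl, ind]
    by_cases hβ : β = γ
    · subst hβ; simp [h]
    · rw [if_neg fun h' => hβ (T.arc_eq_of_mem h' h)]
      simp [hβ]
  · simp

theorem sum_elim_mul (u v : T.Arc → ℤ) : (Multiplicative.ofAdd (Sum.elim u 0) : T.Monomial) *
    Multiplicative.ofAdd (Sum.elim v 0) = Multiplicative.ofAdd (Sum.elim (u + v) 0) := by
  apply Multiplicative.toAdd.injective
  funext i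
  rcases i with β | β <;> simp

end Triangulation

namespace Triangulation

variable {D : Type*} (T : Triangulation D)

/-! ### Rotation about a vertex -/

@[simp] theorem ccw_cw (d : D) : T.ccw (T.cw d) = d := by
  rw [ccw, cw, T.next_next_next, T.opp_opp]

@[simp] theorem cw_ccw (d : D) : T.cw (T.ccw d) = d := by
  rw [ccw, cw, T.opp_opp, T.next_next_next]

theorem cw_injective : Function.Injective T.cw :=
  (Function.LeftInverse.injective T.ccw_cw)

theorem ccw_iterate_eq_iff {k : ℕ} {d d' : D} : T.ccw^[k] d = d' ↔ T.cw^[k] d' = d := by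
  constructor
  · rintro rfl; exact (Function.LeftInverse.iterate T.cw_ccw k) d
  · rintro rfl; exact (Function.LeftInverse.iterate T.ccw_cw k) d'

theorem IsPuncture.src_cw_iterate {v : T.Vertex} (hv : T.IsPuncture v) {d : D} (hd : T.src d = v)
    (k : ℕ) : T.src (T.cw^[k] d) = v := by
  induction k with
  | zero => exact hd
  | succ k ih => rw [Function.iterate_succ_apply', T.src_cw (hv _ ih), ih]

section

variable [Finite D]

/-- The `cw`-orbit of `T.next d` is finite and stays at the puncture. The element from which it
returns to `T.next d` must be `d` if `d` is a boundary segment, so a boundary segment would start at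
the puncture. -/
theorem IsPuncture.interior_of_tgt {v : T.Vertex} (hv : T.IsPuncture v) {d : D}
    (hd : T.tgt d = v) : T.opp d ≠ d := by
  intro h
  obtain ⟨n, hn, hp⟩ := T.cw_injective.mem_periodicPts (T.next d)
  obtain ⟨n, rfl⟩ := Nat.exists_eq_succ_of_ne_zero hn.ne'
  have hp' : T.cw^[n + 1] (T.next d) = T.next d := hp
  rw [Function.iterate_succ_apply'] at hp'
  have hy := T.opp_injective ((T.next_injective hp').trans h.symm)
  have := IsPuncture.src_cw_iterate T hv (d := T.next d) hd n
  rw [hy] at this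
  exact hv d this h

theorem exists_cw_iterate {a b : D} (h : T.src a = T.src b) : ∃ k, T.cw^[k] a = b := by
  have := Quot.eqvGen_exact h
  induction this with
  | rel a b hab => exact ⟨1, hab.2.symm⟩
  | refl a => exact ⟨0, rfl⟩
  | symm a b _ ih =>
    obtain ⟨k, rfl⟩ := ih (Quot.eqvGen_sound ‹_›)
    obtain ⟨n, hn, hp⟩ := T.cw_injective.mem_periodicPts a
    -- With `n` a period of `a`, adding `k` steps to these gives `n * k`, so they undo `k` clockwise
    -- steps.
    refine ⟨n * k - k, ?_⟩
    rw [← Function.iterate_add_apply, Nat.sub_add_cancel (Nat.le_mul_of_pos_left k hn)]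
    exact hp.mul_const k
  | trans a b c _ _ ih₁ ih₂ =>
    obtain ⟨k, rfl⟩ := ih₁ (Quot.eqvGen_sound ‹_›)
    obtain ⟨l, rfl⟩ := ih₂ (Quot.eqvGen_sound ‹_›)
    exact ⟨l + k, Function.iterate_add_apply _ _ _ _⟩

/-- A full turn is added to make the number of steps positive, as the definition of `around` needs.
-/
theorem exists_cw_iterate_succ {a b : D} (h : T.src a = T.src b) : ∃ k, T.cw^[k + 1] a = b := by
  obtain ⟨k, rfl⟩ := T.exists_cw_iterate h
  obtain ⟨n, hn, hp⟩ := T.cw_injective.mem_periodicPts a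
  obtain ⟨n, rfl⟩ := Nat.exists_eq_succ_of_ne_zero hn.ne'
  refine ⟨k + n, ?_⟩
  rw [add_assoc, Function.iterate_add_apply]
  exact congrArg _ hp

theorem notchInterior_of_isPuncture {e : D} {ts : List Turn} {tag : Tag}
    (h : tag = .notched → T.IsPuncture (T.endInto e ts)) : T.NotchInterior e ts tag := by
  intro ht s
  cases s with
  | left => exact h ht _ rfl
  | right => exact IsPuncture.interior_of_tgt T (h ht) rfl

end

/-! ### Reversing a path -/

theorem lastInto_append (e : D) (ts₁ ts₂ : List Turn) :
    T.lastInto e (ts₁ ++ ts₂) = T.lastInto (T.lastInto e ts₁) ts₂ := by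
  induction ts₁ generalizing e with
  | nil => rfl
  | cons t' ts ih => exact ih _

theorem crossInto_append (e : D) (ts₁ ts₂ : List Turn) :
    T.crossInto e (ts₁ ++ ts₂) = T.crossInto e ts₁ ++ T.crossInto (T.lastInto e ts₁) ts₂ := by
  induction ts₁ generalizing e with
  | nil => rfl
  | cons t' ts ih => exact congrArg _ (ih _)

theorem crossFrom_append (d : D) (ts₁ ts₂ : List Turn) :
    T.crossFrom d (ts₁ ++ ts₂) =
      T.crossFrom d ts₁ ++ T.crossInto (T.opp (T.lastCross d ts₁)) ts₂ := by
  rw [crossFrom_eq, crossFrom_eq, crossInto_append, opp_lastCross, List.cons_append]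

theorem lastInto_reverse (d : D) (ts : List Turn) :
    T.lastInto (T.lastCross d ts) (ts.reverse.map Turn.flip) = d := by
  induction ts generalizing d with
  | nil => rfl
  | cons t ts ih =>
    rw [List.reverse_cons, List.map_append, lastInto_append, lastCross, ih]
    simp [lastInto, T.opp_opp]

theorem crossFrom_reverse (d : D) (ts : List Turn) :
    T.crossFrom (T.opp (T.lastCross d ts)) (ts.reverse.map Turn.flip) =
      (T.crossFrom d ts).reverse.map T.opp := by
  induction ts generalizing d with
  | nil => rfl
  | cons t ts ih =>
    rw [List.reverse_cons, List.map_append, crossFrom_append, crossFrom, List.reverse_cons,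
      List.map_append, lastCross, ih, opp_lastCross, T.opp_opp, lastInto_reverse]
    simp [crossInto]

variable {T}

open Classical in
theorem nodup_of_countP_le_one (l : List D) (hl : ∀ x ∈ l, T.opp x ≠ x)
    (h : ∀ γ : T.Arc, l.countP (fun d => d ∈ γ.1) ≤ 1) : (l.map T.edge).Nodup := by
  induction l with
  | nil => exact List.nodup_nil
  | cons y l ih =>
    rw [List.map_cons, List.nodup_cons]
    refine ⟨fun hy => ?_, ih (fun x hx => hl x (List.mem_cons_of_mem _ hx)) fun γ => ?_⟩
    · obtain ⟨x, hx, hxy⟩ := List.mem_map.1 hy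
      have hyi := hl y List.mem_cons_self
      have h1 := h (T.arcOf y hyi)
      rw [List.countP_cons_of_pos (by simpa using T.mem_arcOf y hyi)] at h1
      have h2 : 0 < l.countP (fun d => d ∈ (T.arcOf y hyi).1) := by
        rw [List.countP_pos_iff]
        exact ⟨x, hx, by simpa using T.mem_arc_iff.2 hxy.symm⟩
      lia
    · refine le_trans ?_ (h γ)
      exact (List.sublist_cons_self y l).countP_le

open Classical in
theorem crossNumber_ne_zero {α : TaggedArc D} {γ : T.Arc} {d : D} (h : d ∈ T.crossings α.path)
    (hd : d ∈ γ.1) : T.crossNumber α γ ≠ 0 := by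
  have : 0 < (T.crossings α.path).countP (fun d => d ∈ γ.1) := by
    rw [List.countP_pos_iff]
    exact ⟨d, h, by simpa using hd⟩
  exact this.ne'

theorem isEnd_src {γ : T.Arc} {d : D} (h : d ∈ γ.1) : T.IsEnd γ (T.src d) := ⟨d, h, rfl⟩

theorem isEnd_tgt {γ : T.Arc} {d : D} (h : d ∈ γ.1) : T.IsEnd γ (T.tgt d) :=
  ⟨T.opp d, T.mem_arc_opp.2 h, T.src_opp (T.opp_ne_of_mem h)⟩

/-- The sides crossed by the arc do not end at its endpoints. -/
theorem Tidy.crossings_avoid {α : TaggedArc D} (tidy : T.Tidy α) (hα : T.IsTaggedArc α) {d : D}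
    (hd : d ∈ T.crossings α.path) :
    (T.src d ≠ T.startPt α.path ∧ T.tgt d ≠ T.startPt α.path) ∧
      (T.src d ≠ T.endPt α.path ∧ T.tgt d ≠ T.endPt α.path) := by
  have hm := T.mem_arcOf d (hα.interior_cross d hd)
  obtain ⟨h1, h2⟩ := tidy.cross_or_share _ (crossNumber_ne_zero hd hm)
  exact ⟨⟨fun h => h1 (h ▸ isEnd_src hm), fun h => h1 (h ▸ isEnd_tgt hm)⟩,
    ⟨fun h => h2 (h ▸ isEnd_src hm), fun h => h2 (h ▸ isEnd_tgt hm)⟩⟩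

/-! ### The exchange relations for crossing arcs -/

namespace Exchange

variable [DecidableEq D] [Fintype D] {α : TaggedArc D} {γ : T.Arc}

theorem setYOne_yhatOrange (E : T.Exchange α γ) {tf tb : Tag}
    (h : T.IsExchangeCurve E.SpiralReversed E.transversal.cross E.transversal.fwd
      E.transversal.bwd tf tb) :
    T.setYOne E.yhatOrange = Multiplicative.ofAdd (Sum.elim (fun β =>
      ((T.orangeSides E.transversal.cross E.transversal.fwd E.transversal.bwd tf tb).map fun x =>
        T.cornerInd x β + T.cornerInd (T.opp x) β).sum) 0) := by
  classical
  have key : ∀ δ, E.Orange δ ↔ ∃ x ∈ T.orangeSides E.transversal.cross E.transversal.fwd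
      E.transversal.bwd tf tb, x ∈ δ.1 := fun δ => h.exists_crossesLeftLeft_iff δ
  rw [yhatOrange, setYOne_prod_yhat]
  congr 2
  funext β
  rw [← T.sum_adj_of_nodup _ h.orangeSides_nodup h.orangeSides_interior]
  exact Finset.sum_congr rfl fun δ _ => if_congr (key δ) rfl rfl

end Exchange

variable (T) in
theorem halfShear_right (e : D) (ts : List Turn) (τ : Turn) (γ : T.Arc) :
    T.halfShear .right e ts τ γ = T.halfShear .left e ts τ γ + T.ind e γ := by
  have := congrFun (T.halfShear_sub .right .left e ts τ) γ
  rw [Pi.sub_apply, sub_eq_iff_eq_add] at this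
  rw [this]
  simp [add_comm]

theorem ofAdd_congr {u v : T.Arc → ℤ} (h : ∀ β, u β = v β) :
    (Multiplicative.ofAdd (Sum.elim u 0) : T.Monomial) = Multiplicative.ofAdd (Sum.elim v 0) := by
  rw [funext h]

theorem sum_orangeSides (g : D) (fwd bwd : List Turn) (tf tb : Tag) (f : D → ℤ) :
    ((T.orangeSides g fwd bwd tf tb).map f).sum =
      f g + (((T.fan (T.opp g) fwd tf).map f).sum + ((T.fan g bwd tb).map f).sum) := by
  simp [orangeSides]

section

variable [DecidableEq D] [Fintype D]

-- Tidiness enters here: crossed arcs avoid the endpoints of `α`, hence `Rev`, and `α` crosses each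
-- arc at most once, so the plain fans repeat nothing.
omit [DecidableEq D] in
theorem isExchangeCurve_crossing {α : TaggedArc D} (hα : T.IsTaggedArc α) (tidy : T.Tidy α)
    {d : D} {ts₁ ts₂ : List Turn} (path_eq : α.path = .across d (ts₁ ++ ts₂)) :
    T.IsExchangeCurve (fun v => (v = T.startPt α.path ∧ α.startTag = .notched) ∨
      (v = T.endPt α.path ∧ α.endTag = .notched)) (T.lastCross d ts₁) ts₂
      (ts₁.reverse.map Turn.flip) α.endTag α.startTag := by
  set Rev : T.Vertex → Prop := fun v => (v = T.startPt α.path ∧ α.startTag = .notched) ∨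
      (v = T.endPt α.path ∧ α.endTag = .notched) with hRev
  have hcr : T.crossings α.path =
      T.crossFrom d ts₁ ++ T.crossInto (T.opp (T.lastCross d ts₁)) ts₂ := by
    rw [path_eq, crossings, crossFrom_append]
  have hrv := T.crossFrom_reverse d ts₁
  rw [crossFrom_eq, T.opp_opp] at hrv
  have hav : ∀ x ∈ T.crossings α.path,
      T.opp x ≠ x ∧ ¬ Rev (T.src x) ∧ ¬ Rev (T.tgt x) := by
    intro x hx
    obtain ⟨⟨h1, h2⟩, h3, h4⟩ := tidy.crossings_avoid hα hx
    refine ⟨hα.interior_cross x hx, ?_, ?_⟩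
    · rintro (⟨h, -⟩ | ⟨h, -⟩)
      exacts [h1 h, h3 h]
    · rintro (⟨h, -⟩ | ⟨h, -⟩)
      exacts [h2 h, h4 h]
  have hback : ∀ x ∈ T.opp (T.lastCross d ts₁) ::
      T.crossInto (T.lastCross d ts₁) (ts₁.reverse.map Turn.flip), T.opp x ∈ T.crossings α.path := by
    intro x hx
    rw [hrv, List.mem_map] at hx
    obtain ⟨y, hy, rfl⟩ := hx
    rw [T.opp_opp, hcr]
    exact List.mem_append_left _ (List.mem_reverse.1 hy)
  have hgm : T.lastCross d ts₁ ∈ T.crossings α.path := by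
    simpa [T.opp_opp] using hback _ List.mem_cons_self
  have hendf : T.endInto (T.opp (T.lastCross d ts₁)) ts₂ = T.endPt α.path := by
    rw [path_eq, endPt_across, endInto, lastInto_append, opp_lastCross]
  have hendb : T.endInto (T.lastCross d ts₁) (ts₁.reverse.map Turn.flip) = T.startPt α.path := by
    rw [path_eq, endInto, lastInto_reverse, startPt]
  have hne := tidy.distinct_ends
  refine ⟨hav _ hgm, fun x hx => hav x ?_, fun x hx => ?_, ?_, ?_, ?_, ?_,
    tidy.distinct_vertices _, ?_⟩
  · rw [hcr]; exact List.mem_append_right _ hx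
  · have h := hav _ (hback x (List.mem_cons_of_mem _ hx))
    have hx' : T.opp x ≠ x := fun h' => h.1 (by rw [h', h'])
    rw [T.src_opp hx', T.tgt_opp hx'] at h
    exact ⟨hx', h.2.2, h.2.1⟩
  · rw [hendf]; simp [hRev, hne.symm]
  · rw [hendb]; simp [hRev, hne]
  · exact T.notchInterior_of_isPuncture (by rw [hendf]; exact hα.end_tag)
  · exact T.notchInterior_of_isPuncture (by rw [hendb]; exact hα.start_tag)
  · have hnd := nodup_of_countP_le_one _ hα.interior_cross tidy.cross_once
    rw [hcr, List.map_append] at hnd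
    have hrv' := congrArg (List.map T.edge) hrv
    rw [List.map_cons, edge_opp, List.map_map,
      show T.edge ∘ T.opp = T.edge from funext T.edge_opp] at hrv'
    -- Up to order and direction, `g` and the sides crossed by the two halves are the crossings of
    -- `α`.
    have hp : ((T.crossFrom d ts₁).map T.edge ++
        (T.crossInto (T.opp (T.lastCross d ts₁)) ts₂).map T.edge).Perm
        (T.edge (T.lastCross d ts₁) :: ((T.crossInto (T.opp (T.lastCross d ts₁)) ts₂).map T.edge ++
          (T.crossInto (T.lastCross d ts₁) (ts₁.reverse.map Turn.flip)).map T.edge)) := by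
      refine (((List.reverse_perm (T.crossFrom d ts₁)).map T.edge).symm.append_right _).trans ?_
      rw [← hrv', List.cons_append]
      exact List.perm_append_comm.cons _
    rw [hp.nodup_iff, ← List.map_append, ← List.map_cons] at hnd
    exact hnd.sublist ((((fan_sublist _ _).append (fan_sublist _ _)).cons_cons _).map _)

theorem exchange_crossing {α : TaggedArc D} (hα : T.IsTaggedArc α) (tidy : T.Tidy α) {γ : T.Arc}
    {d : D} {ts₁ ts₂ : List Turn} (path_eq : α.path = .across d (ts₁ ++ ts₂))
    (mem : T.lastCross d ts₁ ∈ γ.1) (once : T.crossNumber α γ = 1)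
    (start_plain : T.IsEnd γ (T.startPt α.path) → α.startTag = .plain)
    (end_plain : T.IsEnd γ (T.endPt α.path) → α.endTag = .plain) :
    let E : T.Exchange α γ := .crossing d ts₁ ts₂ path_eq mem once start_plain end_plain
    E.gBlue = T.x γ * T.g α ∧ E.gRed = T.x γ * T.g α * T.setYOne E.yhatOrange := by
  intro E
  have h := isExchangeCurve_crossing hα tidy path_eq
  have hshear : ∀ β, T.shear β (T.kappa α) =
      T.halfShear .left (T.opp (T.lastCross d ts₁)) ts₂ α.endTag.turn β +
        T.halfShear .right (T.lastCross d ts₁) (ts₁.reverse.map Turn.flip) α.startTag.turn β := by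
    intro β
    rw [kappa_eq, path_eq]
    refine T.shear_across_split (fun x hx => hα.interior_cross x ?_) _ _ .left β
    rw [path_eq]; exact hx
  have hf : ∀ x ∈ T.crossInto (T.opp (T.lastCross d ts₁)) ts₂, T.opp x ≠ x :=
    fun x hx => (h.avoids_fwd x hx).1
  have hb : ∀ x ∈ T.crossInto (T.lastCross d ts₁) (ts₁.reverse.map Turn.flip), T.opp x ≠ x :=
    fun x hx => (h.avoids_bwd x hx).1
  have e1 := T.halfShear_right (T.opp (T.lastCross d ts₁)) ts₂ α.endTag.turn
  have e2 := T.halfShear_right (T.lastCross d ts₁) (ts₁.reverse.map Turn.flip) α.startTag.turn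
  rw [E.setYOne_yhatOrange h, T.x_eq mem, T.g_eq, sum_elim_mul, sum_elim_mul, Exchange.gBlue,
    Exchange.gRed, T.gProd_eq, T.gProd_eq]
  refine ⟨ofAdd_congr fun β => ?_, ofAdd_congr fun β => ?_⟩
  · simp only [E, Exchange.blue, Exchange.transversal, List.map_cons, List.map_nil, List.sum_cons,
      List.sum_nil, Pi.add_apply, hshear]
    rw [T.sideShear_leftSide hf h.interior_fwd, T.sideShear_leftSide hb h.interior_bwd]
    -- The blue sides are both entered after a left turn, whereas the backward half of `α` is
    -- entered after a right turn; the difference is `ind g`.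
    linarith [e2 β]
  · simp only [E, Exchange.red, Exchange.transversal, List.map_cons, List.map_nil, List.sum_cons,
      List.sum_nil, Pi.add_apply, hshear, sum_orangeSides]
    rw [T.sideShear_rightSide hf h.interior_fwd, T.sideShear_rightSide hb h.interior_bwd]
    -- Entering both halves after a right turn adds `ind g`, and the two red corrections remove it
    -- twice, which leaves `-ind g` and the orange columns.
    linarith [e1 β, e2 β, congrFun (T.ind_opp (T.lastCross d ts₁)) β]

end

end Triangulation

namespace Triangulation

variable {D : Type*} {T : Triangulation D}

/-! ### The same arc in the opposite direction -/

theorem crossings_revPath (p : ArcPath D) :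
    T.crossings (T.revPath p) = (T.crossings p).reverse.map T.opp := by
  cases p with
  | along a => rfl
  | across d ts => exact T.crossFrom_reverse d ts

theorem startPt_revPath {p : ArcPath D} (h : ∀ a, p = .along a → T.opp a ≠ a) :
    T.startPt (T.revPath p) = T.endPt p := by
  cases p with
  | along a => exact T.src_opp (h a rfl)
  | across d ts => rfl

theorem endPt_revPath {p : ArcPath D} (h : ∀ a, p = .along a → T.opp a ≠ a) :
    T.endPt (T.revPath p) = T.startPt p := by
  cases p with
  | along a => exact T.tgt_opp (h a rfl)
  | across d ts => rw [revPath, endPt_across, T.opp_opp, lastInto_reverse, startPt]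

variable (T) in
/-- A tagged arc with the opposite direction. -/
def revArc (α : TaggedArc D) : TaggedArc D := ⟨T.revPath α.path, α.endTag, α.startTag⟩

section

variable {α : TaggedArc D}

theorem IsTaggedArc.rev (hα : T.IsTaggedArc α) : T.IsTaggedArc (T.revArc α) where
  interior_cross d hd := by
    rw [revArc, crossings_revPath, List.mem_map] at hd
    obtain ⟨x, hx, rfl⟩ := hd
    exact T.opp_opp_ne (hα.interior_cross x (List.mem_reverse.1 hx))
  interior_along a ha := by
    obtain ⟨_ | _, s, e⟩ := α
    · cases ha
      exact T.opp_opp_ne (hα.interior_along _ rfl)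
    · cases ha
  start_tag h := by
    rw [revArc, startPt_revPath hα.interior_along]; exact hα.end_tag h
  end_tag h := by
    rw [revArc, endPt_revPath hα.interior_along]; exact hα.start_tag h

theorem crossNumber_revArc (γ : T.Arc) : T.crossNumber (T.revArc α) γ = T.crossNumber α γ := by
  classical
  rw [crossNumber, crossNumber, revArc, crossings_revPath, List.countP_map, List.countP_reverse]
  refine List.countP_congr fun x _ => ?_
  simp [T.mem_arc_opp]

theorem coincides_revArc {γ : T.Arc} : T.Coincides (T.revArc α) γ ↔ T.Coincides α γ := by
  obtain ⟨_ | _, s, e⟩ := α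
  · simp [Coincides, revArc, revPath, T.mem_arc_opp]
  · simp [Coincides, revArc, revPath]

theorem Tidy.rev (tidy : T.Tidy α) (hα : T.IsTaggedArc α) : T.Tidy (T.revArc α) := by
  have h1 : T.startPt (T.revArc α).path = T.endPt α.path := startPt_revPath hα.interior_along
  have h2 : T.endPt (T.revArc α).path = T.startPt α.path := endPt_revPath hα.interior_along
  refine ⟨tidy.distinct_vertices, tidy.distinct_edges, ?_, fun γ => ?_, fun γ => ?_, fun γ => ?_⟩
  · rw [h1, h2]; exact tidy.distinct_ends.symm
  · rw [crossNumber_revArc]; exact tidy.cross_once γ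
  · rw [crossNumber_revArc, h1, h2]; exact fun h => (tidy.cross_or_share γ h).symm
  · rw [coincides_revArc, h1, h2]; exact fun h h' => tidy.same_ends γ h' h

/-- For an arc that crosses `T`, both directions are compared by splitting at the last crossing of
the path, which is the first one of the reversed path. -/
theorem shear_revArc [DecidableEq D] (hα : T.IsTaggedArc α) (γ : T.Arc) :
    T.shear γ (T.kappa (T.revArc α)) = T.shear γ (T.kappa α) := by
  rw [kappa_eq, kappa_eq]
  obtain ⟨a | ⟨d, ts⟩, s, e⟩ := α
  · cases s <;> cases e <;> simp only [revArc, revPath, Tag.turn]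
    · rw [T.shear_along_left_left, T.shear_along_left_left, T.ind_opp]
    · rw [T.shear_along_left_right, T.shear_along_right_left]
    · rw [T.shear_along_left_right, T.shear_along_right_left, T.opp_opp]
    · rw [T.shear_along_right_right, T.shear_along_right_right, T.ind_opp]
  · have h1 := T.shear_across_split (ts₁ := ts) (ts₂ := []) (d := d)
      (by rw [List.append_nil]; exact hα.interior_cross) s.turn e.turn .left γ
    have h2 := T.shear_across_split (ts₁ := []) (ts₂ := ts.reverse.map Turn.flip)
      (d := T.opp (T.lastCross d ts)) (hα.rev.interior_cross) e.turn s.turn .right γ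
    rw [List.append_nil] at h1
    simp only [revArc, revPath]
    rw [h1]
    refine h2.trans ?_
    rw [add_comm, lastCross, T.opp_opp]
    rfl

end

/-! ### Curves around a puncture -/

theorem crossInto_replicate_right {g x : D} {k : ℕ}
    (h : x ∈ T.crossInto (T.opp g) (List.replicate k .right)) :
    ∃ j ≤ k, x = T.cw^[j] g := by
  induction k generalizing g with
  | zero => simp [crossInto] at h
  | succ k ih =>
    rw [List.replicate_succ, crossInto, List.mem_cons] at h
    rcases h with rfl | h
    · exact ⟨1, by lia, rfl⟩
    · obtain ⟨j, hj, rfl⟩ := ih h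
      exact ⟨j + 1, by lia, rfl⟩

theorem crossInto_replicate_left {g x : D} {k : ℕ}
    (h : x ∈ T.crossInto g (List.replicate k .left)) : ∃ j ≤ k, x = T.opp (T.ccw^[j] g) := by
  induction k generalizing g with
  | zero => simp [crossInto] at h
  | succ k ih =>
    rw [List.replicate_succ, crossInto, List.mem_cons] at h
    rcases h with rfl | h
    · exact ⟨1, by lia, (T.opp_opp _).symm⟩
    · obtain ⟨j, hj, rfl⟩ := ih h
      exact ⟨j + 1, by lia, rfl⟩

theorem lastInto_replicate_right (g : D) (k : ℕ) :
    T.lastInto (T.opp g) (List.replicate k .right) = T.opp (T.cw^[k] g) := by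
  induction k generalizing g with
  | zero => rfl
  | succ k ih => exact ih (T.cw g)

theorem lastInto_replicate_left (g : D) (k : ℕ) :
    T.lastInto g (List.replicate k .left) = T.ccw^[k] g := by
  induction k generalizing g with
  | zero => rfl
  | succ k ih => exact ih (T.ccw g)

/-- Turning around the puncture costs nothing, so the forward half of the curve around it can be
compared with `α` alone. -/
theorem halfShear_replicate_right (g : D) (k : ℕ) (ts : List Turn) (τ : Turn) :
    T.halfShear .right (T.opp g) (List.replicate k .right ++ ts) τ =
      T.halfShear .right (T.opp (T.cw^[k] g)) ts τ := by
  induction k generalizing g with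
  | zero => rfl
  | succ k ih =>
    rw [List.replicate_succ, List.cons_append, halfShear, sub_self, zero_smul, zero_add]
    exact ih (T.cw g)

theorem halfShear_replicate_left (g : D) (k : ℕ) (ts : List Turn) (τ : Turn) :
    T.halfShear .left g (List.replicate k .left ++ ts) τ =
      T.halfShear .left (T.ccw^[k] g) ts τ := by
  induction k generalizing g with
  | zero => rfl
  | succ k ih =>
    rw [List.replicate_succ, List.cons_append, halfShear, sub_self, zero_smul, zero_add]
    exact ih (T.ccw g)

theorem rightSide_replicate (g : D) (k : ℕ) (ts : List Turn) (tag : Tag) :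
    T.rightSide (T.opp g) (List.replicate k .right ++ ts) tag =
      T.rightSide (T.opp (T.cw^[k] g)) ts tag := by
  induction k generalizing g with
  | zero => rfl
  | succ k ih => exact ih (T.cw g)

theorem cons_fan_replicate (g : D) (k : ℕ) (ts : List Turn)
    (h : ∀ e, T.fan e ts .plain = []) :
    g :: T.fan (T.opp g) (List.replicate k .right ++ ts) .plain =
      (List.range (k + 1)).map fun i => T.cw^[i] g := by
  rw [List.range_map_iterate]
  induction k generalizing g with
  | zero => simp [h]
  | succ k ih =>
    rw [List.replicate_succ, List.cons_append, fan, List.iterate]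
    exact congrArg _ (ih (T.cw g))

variable [Fintype D]

theorem IsPuncture.src_ccw_iterate {v : T.Vertex} (hv : T.IsPuncture v) {d : D} (hd : T.src d = v)
    (k : ℕ) : T.src (T.ccw^[k] d) = v := by
  induction k with
  | zero => exact hd
  | succ k ih =>
    have ht : T.tgt (T.next (T.next (T.ccw^[k] d))) = v := by rw [tgt, T.next_next_next, ih]
    rw [Function.iterate_succ_apply', ccw, T.src_opp (IsPuncture.interior_of_tgt T hv ht), ht]

/-- A description of the curve around the puncture at which `α` and `g` start: `k` and `l` arcs are
crossed in the two directions, before the curve follows `α`. -/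
structure GoesAround (T : Triangulation D) (α : TaggedArc D) (g : D) (k l : ℕ)
    (X Y : List Turn) : Prop where
  src_eq : T.src g = T.startPt α.path
  start_notched : α.startTag = .notched
  cross_fwd : T.crossInto (T.opp (T.cw^[k] g)) X = T.crossings α.path
  cross_bwd : T.crossInto (T.ccw^[l] g) Y = T.crossings α.path
  end_fwd : T.endInto (T.opp (T.cw^[k] g)) X = T.endPt α.path
  end_bwd : T.endInto (T.ccw^[l] g) Y = T.endPt α.path
  fan_fwd : ∀ e, T.fan e X .plain = []
  ne_fwd : ∀ b, α.path = .along b → ∀ j ≤ k, T.cw^[j] g ≠ b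
  ne_bwd : ∀ b, α.path = .along b → ∀ j ≤ l, T.ccw^[j] g ≠ b
  first : ∀ j < k, T.cw^[j + 1] g ≠ T.cw^[k + 1] g

namespace GoesAround

variable {α : TaggedArc D} {g : D} {k l : ℕ} {X Y : List Turn}

-- A spoke at the puncture that also reached the other end of `α` would coincide with `α` by
-- tidiness. The spoke along `α` is excluded by `hb`, and its reverse starts at the wrong end.
omit [Fintype D] in
theorem avoids_spoke (hα : T.IsTaggedArc α) (tidy : T.Tidy α) (hs : α.startTag = .notched)
    {z : D} (hz : T.src z = T.startPt α.path) (hb : ∀ b, α.path = .along b → z ≠ b) :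
    T.opp z ≠ z ∧ ¬ (T.src z = T.endPt α.path ∧ α.endTag = .notched) ∧
      ¬ (T.tgt z = T.endPt α.path ∧ α.endTag = .notched) := by
  have hi := hα.start_tag hs z hz
  have hm := T.mem_arcOf z hi
  refine ⟨hi, fun h => tidy.distinct_ends (hz.symm.trans h.1), fun h => ?_⟩
  obtain ⟨c, hc, hc'⟩ := tidy.same_ends _ (hz ▸ isEnd_src hm) (h.1 ▸ isEnd_tgt hm)
  rcases hc with rfl | hc
  · exact hb _ hc' rfl
  · rw [Set.mem_singleton_iff] at hc
    subst hc
    apply tidy.distinct_ends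
    rw [← h.1]
    conv_lhs => rw [hc', startPt, T.src_opp hi]

theorem isExchangeCurve (h : GoesAround T α g k l X Y) (hα : T.IsTaggedArc α) (tidy : T.Tidy α) :
    T.IsExchangeCurve (fun v => v = T.endPt α.path ∧ α.endTag = .notched) g
      (List.replicate k .right ++ X) (List.replicate l .left ++ Y) α.endTag α.endTag := by
  have hp := hα.start_tag h.start_notched
  have hcw : ∀ j, T.src (T.cw^[j] g) = T.startPt α.path := hp.src_cw_iterate T h.src_eq
  have hccw : ∀ j, T.src (T.ccw^[j] g) = T.startPt α.path := hp.src_ccw_iterate h.src_eq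
  have hcross : ∀ x ∈ T.crossings α.path, T.opp x ≠ x ∧
      ¬ (T.src x = T.endPt α.path ∧ α.endTag = .notched) ∧
      ¬ (T.tgt x = T.endPt α.path ∧ α.endTag = .notched) := fun x hx => by
    obtain ⟨-, h1, h2⟩ := tidy.crossings_avoid hα hx
    exact ⟨hα.interior_cross x hx, fun h => h1 h.1, fun h => h2 h.1⟩
  have endf : T.endInto (T.opp g) (List.replicate k .right ++ X) = T.endPt α.path := by
    rw [← h.end_fwd, endInto, endInto, lastInto_append, lastInto_replicate_right]
  have endb : T.endInto g (List.replicate l .left ++ Y) = T.endPt α.path := by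
    rw [← h.end_bwd, endInto, endInto, lastInto_append, lastInto_replicate_left]
  refine ⟨avoids_spoke hα tidy h.start_notched h.src_eq fun b hb => h.ne_fwd b hb 0 k.zero_le,
    fun x hx => ?_, fun x hx => ?_, by simp [endf], by simp [endb],
    T.notchInterior_of_isPuncture (by rw [endf]; exact hα.end_tag),
    T.notchInterior_of_isPuncture (by rw [endb]; exact hα.end_tag), tidy.distinct_vertices g, ?_⟩
  · rw [crossInto_append, lastInto_replicate_right, h.cross_fwd, List.mem_append] at hx
    rcases hx with hx | hx
    · obtain ⟨j, hj, rfl⟩ := crossInto_replicate_right hx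
      exact avoids_spoke hα tidy h.start_notched (hcw j) fun b hb => h.ne_fwd b hb j hj
    · exact hcross x hx
  · rw [crossInto_append, lastInto_replicate_left, h.cross_bwd, List.mem_append] at hx
    rcases hx with hx | hx
    · obtain ⟨j, hj, rfl⟩ := crossInto_replicate_left hx
      have := avoids_spoke hα tidy h.start_notched (hccw j) fun b hb => h.ne_bwd b hb j hj
      rw [T.src_opp this.1, T.tgt_opp this.1]
      exact ⟨T.opp_opp_ne this.1, this.2.2, this.2.1⟩
    · exact hcross x hx
  -- The backward fan is empty as soon as one left turn is made, so only `l = 0` matters.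
  · have hsub : (T.fan g (List.replicate l .left ++ Y) .plain).Sublist (T.crossings α.path) := by
      rcases l with _ | l
      · rw [← h.cross_bwd]; exact fan_sublist _ _
      · exact List.nil_sublist _
    rw [← List.cons_append, cons_fan_replicate g k X h.fan_fwd, List.map_append, List.nodup_append]
    refine ⟨?_, ?_, ?_⟩
    · rw [List.map_map]
      refine List.Nodup.map_on ?_ List.nodup_range
      -- Two equal spokes, rotated further by `k + 1 - j` steps, would reach the target of the
      -- rotation earlier than `k` allows.
      have key : ∀ i j, i < j → j ≤ k → T.cw^[i] g ≠ T.cw^[j] g := by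
        intro i j hij hj he
        have h1 := congrArg (T.cw^[k + 1 - j]) he
        rw [← Function.iterate_add_apply, ← Function.iterate_add_apply,
          show k + 1 - j + i = (k - j + i) + 1 by lia, show k + 1 - j + j = k + 1 by lia] at h1
        exact h.first (k - j + i) (by lia) h1
      intro i hi j hj he
      rw [List.mem_range] at hi hj
      rcases T.edge_eq_iff.1 he with he | he
      · rcases lt_trichotomy i j with hij | hij | hij
        · exact absurd he (key i j hij (by lia))
        · exact hij
        · exact absurd he.symm (key j i hij (by lia))
      · refine absurd ?_ (tidy.distinct_vertices (T.cw^[j] g))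
        have h1 := hcw i
        rw [show T.cw^[i] g = T.opp (T.cw^[j] g) from he, T.src_opp (hp _ (hcw j)), ← hcw j] at h1
        exact h1.symm
    · exact (nodup_of_countP_le_one _ hα.interior_cross tidy.cross_once).sublist (hsub.map _)
    -- Spokes end at the puncture, but arcs crossed by `α` do not.
    · intro e he e' he' hee
      subst hee
      obtain ⟨z, hz, rfl⟩ := List.mem_map.1 he
      obtain ⟨i, -, rfl⟩ := List.mem_map.1 hz
      obtain ⟨x, hx, hxe⟩ := List.mem_map.1 he'
      have hx' := (tidy.crossings_avoid hα (hsub.subset hx)).1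
      rcases T.edge_eq_iff.1 hxe with rfl | rfl
      · exact hx'.1 (hcw i)
      · rw [T.tgt_opp (hp _ (hcw i))] at hx'
        exact hx'.2 (hcw i)

variable [DecidableEq D]

/-- The arc in `plain_eq` is `α` made plain at the puncture, the dotted red side. Its two
descriptions, as right side of the forward half and by the backward half, link the red arc to `α`.
-/
theorem exchange_relation (h : GoesAround T α g k l X Y) (hα : T.IsTaggedArc α) (tidy : T.Tidy α)
    (shear_eq : ∀ β, T.shear β (T.kappa α) =
      T.halfShear .right (T.opp (T.cw^[k] g)) X α.endTag.turn β)
    (plain_eq : ∀ β, T.sideShear (T.rightSide (T.opp (T.cw^[k] g)) X α.endTag) β =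
      T.halfShear .left (T.ccw^[l] g) Y α.endTag.turn β)
    {α' : TaggedArc D} {γ : T.Arc} (hg : g ∈ γ.1) (E : T.Exchange α' γ)
    (g_eq : T.g α' = T.g α)
    (transversal_eq : E.transversal =
      ⟨g, List.replicate k .right ++ X, List.replicate l .left ++ Y⟩)
    (reversed_eq : ∀ v, E.SpiralReversed v ↔ v = T.endPt α.path ∧ α.endTag = .notched)
    (blue_eq : E.blue = [T.leftSide (T.opp g) (List.replicate k .right ++ X) α.endTag])
    (red_eq : E.red = [T.rightSide g (List.replicate l .left ++ Y) α.endTag]) :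
    E.gBlue = T.x γ * T.g α' ∧ E.gRed = T.x γ * T.g α' * T.setYOne E.yhatOrange := by
  have hc := h.isExchangeCurve hα tidy
  have hc' : T.IsExchangeCurve E.SpiralReversed E.transversal.cross E.transversal.fwd
      E.transversal.bwd α.endTag α.endTag := by
    rw [transversal_eq, funext fun v => propext (reversed_eq v)]
    exact hc
  have hf := fun x hx => (hc.avoids_fwd x hx).1
  have hb := fun x hx => (hc.avoids_bwd x hx).1
  have e1 := T.halfShear_right (T.opp g) (List.replicate k .right ++ X) α.endTag.turn
  have e2 := T.halfShear_right g (List.replicate l .left ++ Y) α.endTag.turn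
  rw [halfShear_replicate_right] at e1
  rw [halfShear_replicate_left] at e2
  -- This supplies the forward half of the orange sum; the red arc itself supplies `g` and the
  -- backward fan.
  have hplain : ∀ β, _ := fun β => T.sideShear_rightSide hf hc.interior_fwd β
  simp only [rightSide_replicate, plain_eq, halfShear_replicate_right] at hplain
  rw [E.setYOne_yhatOrange hc', transversal_eq, T.x_eq hg, g_eq, T.g_eq, sum_elim_mul,
    sum_elim_mul, Exchange.gBlue, Exchange.gRed, T.gProd_eq, T.gProd_eq, blue_eq, red_eq]
  refine ⟨ofAdd_congr fun β => ?_, ofAdd_congr fun β => ?_⟩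
  · simp only [List.map_cons, List.map_nil, List.sum_cons, List.sum_nil, Pi.add_apply, shear_eq]
    rw [T.sideShear_leftSide hf hc.interior_fwd]
    linarith [e1 β, congrFun (T.ind_opp g) β]
  · simp only [List.map_cons, List.map_nil, List.sum_cons, List.sum_nil, Pi.add_apply, shear_eq,
      sum_orangeSides]
    rw [T.sideShear_rightSide hb hc.interior_bwd]
    linarith [e2 β, hplain β, congrFun (T.ind_opp g) β]

end GoesAround

omit [Fintype D] in
theorem around_cross (p : ArcPath D) (g : D) : (T.around p g).cross = g := by
  cases p <;> rfl

/-! ### The exchange relations at a shared puncture -/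

section

variable [DecidableEq D]

theorem exchange_around {α : TaggedArc D} {g : D} (hα : T.IsTaggedArc α) (tidy : T.Tidy α)
    (src_eq : T.src g = T.startPt α.path) (start_notched : α.startTag = .notched)
    {α' : TaggedArc D} {γ : T.Arc} (hg : g ∈ γ.1) (not_coincide : ¬ T.Coincides α γ)
    (E : T.Exchange α' γ) (g_eq : T.g α' = T.g α)
    (transversal_eq : E.transversal = T.around α.path g)
    (reversed_eq : ∀ v, E.SpiralReversed v ↔ v = T.endPt α.path ∧ α.endTag = .notched)
    (blue_eq : E.blue = [T.leftSide (T.opp g) (T.around α.path g).fwd α.endTag])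
    (red_eq : E.red = [T.rightSide g (T.around α.path g).bwd α.endTag]) :
    E.gBlue = T.x γ * T.g α' ∧ E.gRed = T.x γ * T.g α' * T.setYOne E.yhatOrange := by
  obtain ⟨p, s, e⟩ := α
  obtain rfl : s = .notched := start_notched
  rcases p with b | ⟨d, ts⟩
  · have hgb : g ≠ b := fun h => not_coincide ⟨g, hg, by rw [h]⟩
    have hb : T.opp b ≠ b := hα.interior_along b rfl
    have hk := Nat.sInf_mem (s := {k | T.cw^[k + 1] g = b}) (T.exists_cw_iterate_succ src_eq)
    have hl := Nat.sInf_mem (s := {k | T.ccw^[k + 1] g = b}) (by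
      obtain ⟨k, hk⟩ := T.exists_cw_iterate_succ src_eq.symm
      exact ⟨k, T.ccw_iterate_eq_iff.2 hk⟩)
    have hk' := fun j => Nat.notMem_of_lt_sInf (s := {k | T.cw^[k + 1] g = b}) (m := j)
    have hl' := fun j => Nat.notMem_of_lt_sInf (s := {k | T.ccw^[k + 1] g = b}) (m := j)
    simp only [around] at transversal_eq blue_eq red_eq
    set k := sInf {k | T.cw^[k + 1] g = b}
    set l := sInf {k | T.ccw^[k + 1] g = b}
    have hk1 : T.next (T.opp (T.cw^[k] g)) = b := by
      rw [← hk, Function.iterate_succ_apply']; rfl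
    have hl1 : T.opp (T.next (T.next (T.ccw^[l] g))) = b := by
      rw [← hl, Function.iterate_succ_apply']; rfl
    have hl2 : T.next (T.next (T.ccw^[l] g)) = T.opp b := by rw [← hl1, T.opp_opp]
    have hk3 : T.opp (T.cw^[k] g) = T.next (T.next b) := by rw [← hk1, T.next_next_next]
    have hl3 : T.ccw^[l] g = T.next (T.opp b) := by rw [← hl2, T.next_next_next]
    have H : GoesAround T ⟨.along b, .notched, e⟩ g k l [] [] := by
      refine ⟨src_eq, rfl, rfl, rfl, ?_, ?_, fun _ => rfl, ?_, ?_, ?_⟩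
      · rw [endInto, lastInto, hk1]; rfl
      · rw [endInto, lastInto, hl2, T.src_opp hb]; rfl
      · intro b' hb' j hj
        cases hb'
        rcases j with _ | j
        · exact hgb
        · exact hk' j hj
      · intro b' hb' j hj
        cases hb'
        rcases j with _ | j
        · exact hgb
        · exact hl' j hj
      · intro j hj
        rw [show T.cw^[k + 1] g = b from hk]
        exact hk' j hj
    refine H.exchange_relation hα tidy (fun β => ?_) (fun β => ?_) hg E g_eq
      (by simpa using transversal_eq) reversed_eq (by simpa using blue_eq) (by simpa using red_eq)
    · rw [hk3, kappa_eq, T.halfShear_nil]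
      cases e with
      | plain =>
        simp only [Tag.turn]
        rw [T.shear_along_right_left]
        simp [Turn.flip, exit, T.next_next_next]
        ring
      | notched =>
        simp only [Tag.turn]
        rw [T.shear_along_right_right]
        simp [Turn.flip, exit, T.next_next_next]
    · rw [rightSide, hk1, hl3, T.halfShear_nil]
      cases e with
      | plain =>
        rw [T.sideShear_along_plain]
        simp [Tag.turn, Turn.flip, exit, T.next_next_next, T.ind_opp]
      | notched =>
        rw [T.sideShear_along_interior hb]
        simp only [Tag.turn]
        rw [T.shear_along_left_right]
        simp [Turn.flip, exit]
        ring
  · have src_eq' : T.src g = T.src (T.next (T.next d)) := src_eq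
    have hk := Nat.sInf_mem (s := {k | T.cw^[k + 1] g = T.next (T.next d)})
      (T.exists_cw_iterate_succ src_eq')
    -- Zero steps are allowed here, unlike clockwise: `g` may already be the side through which the
    -- backward half enters the first triangle of `α`.
    have hl := Nat.sInf_mem (s := {k | T.ccw^[k] g = T.next (T.next d)}) (by
      obtain ⟨k, hk⟩ := T.exists_cw_iterate src_eq'.symm
      exact ⟨k, T.ccw_iterate_eq_iff.2 hk⟩)
    have hk' := fun j => Nat.notMem_of_lt_sInf
      (s := {k | T.cw^[k + 1] g = T.next (T.next d)}) (m := j)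
    simp only [around] at transversal_eq blue_eq red_eq
    set k := sInf {k | T.cw^[k + 1] g = T.next (T.next d)}
    set l := sInf {k | T.ccw^[k] g = T.next (T.next d)}
    replace hl : T.ccw^[l] g = T.next (T.next d) := hl
    have hk1 : T.next (T.opp (T.cw^[k] g)) = T.next (T.next d) := by
      rw [← hk, Function.iterate_succ_apply']; rfl
    have hk2 : T.opp (T.cw^[k] g) = T.next d := T.next_injective hk1
    have hd : T.exit .left (T.next d) = d := T.next_next_next d
    have hd' : T.exit .right (T.next (T.next d)) = d := T.next_next_next d
    have hint : ∀ x ∈ T.crossFrom d ts, T.opp x ≠ x := hα.interior_cross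
    have H : GoesAround T ⟨.across d ts, .notched, e⟩ g k l (.left :: ts) (.right :: ts) := by
      refine ⟨src_eq, rfl, ?_, ?_, ?_, ?_, fun _ => rfl, fun b hb => (by cases hb),
        fun b hb => (by cases hb), fun j hj => ?_⟩
      · rw [hk2, crossInto, hd, crossings, crossFrom_eq]
      · rw [hl, crossInto, hd', crossings, crossFrom_eq]
      · rw [hk2, endInto, lastInto, hd, endPt_across]
      · rw [hl, endInto, lastInto, hd', endPt_across]
      · rw [show T.cw^[k + 1] g = _ from hk]
        exact hk' j hj
    refine H.exchange_relation hα tidy (fun β => ?_) (fun β => ?_) hg E g_eq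
      transversal_eq reversed_eq blue_eq red_eq
    · rw [hk2, kappa_eq, T.halfShear_cons, hd, T.shear_across hint]
      simp [Tag.turn, Turn.flip, exit]
      ring
    · rw [hk2, hl, rightSide, hd, T.sideShear_across, T.shear_across hint, T.halfShear_cons, hd']
      simp [Tag.turn, Turn.flip, exit]
      ring

end

end Triangulation

theorem proposition3p2 {D : Type*} [Fintype D] [DecidableEq D] (T : Triangulation D)
    (hT : T.IsMarkedSurface) (α : TaggedArc D) (hα : T.IsTaggedArc α) (tidy : T.Tidy α)
    (γ : T.Arc) (E : T.Exchange α γ) :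
    E.gBlue = T.x γ * T.g α ∧
    E.gRed = T.x γ * T.g α * T.setYOne E.yhatOrange := by
  cases E with
  | crossing d ts₁ ts₂ path_eq mem once start_plain end_plain =>
    exact Triangulation.exchange_crossing hα tidy path_eq mem once start_plain end_plain
  | sharedStart a mem src_eq start_notched no_cross not_coincide end_plain =>
    exact Triangulation.exchange_around hα tidy src_eq start_notched mem not_coincide _ rfl rfl
      (fun v => Iff.rfl)
      (congrArg (fun c => [T.leftSide (T.opp c) _ _]) (Triangulation.around_cross _ _))
      (congrArg (fun c => [T.rightSide c _ _]) (Triangulation.around_cross _ _))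
  | sharedEnd a mem src_eq end_notched no_cross not_coincide start_plain =>
    -- Reversing `α` reduces a puncture shared at the end to one shared at the start.
    have hg : T.g α = T.g (T.revArc α) := by
      rw [T.g_eq, T.g_eq]
      exact Triangulation.ofAdd_congr fun β => by rw [Triangulation.shear_revArc hα]
    refine Triangulation.exchange_around hα.rev (tidy.rev hα)
      (src_eq.trans (Triangulation.startPt_revPath hα.interior_along).symm) end_notched mem
      (fun h => not_coincide (Triangulation.coincides_revArc.1 h)) _ hg rfl (fun v => ?_) ?_ ?_
    · rw [show T.endPt (T.revArc α).path = T.startPt α.path from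
        Triangulation.endPt_revPath hα.interior_along]
      exact Iff.rfl
    · exact congrArg (fun c => [T.leftSide (T.opp c) _ _]) (Triangulation.around_cross _ _)
    · exact congrArg (fun c => [T.rightSide c _ _]) (Triangulation.around_cross _ _)
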